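/- Let $n\ge 1$ and let $\eta,\lambda,\mu$ be real with $0<\eta<\lambda<\pi-\eta$ and $\eta-\lambda<\mu<\lambda-\eta$. **20V model with DWBC2.** Consider the nodes $(i,j)$, $1\le i,j\le n$, of the square lattice together with all horizontal edges $(i,j)\to(i+1,j)$, vertical edges $(i,j)\to(i,j-1)$ and diagonal edges $(i,j)\to(i+1,j-1)$ incident to at least one of them. A configuration is a set of occupied edges such that at each node as many occupied edges enter (from North, Northwest, West) as exit (to East, Southeast, South), the horizontal and diagonal edges of the left boundary and the vertical and diagonal edges of the bottom boundary being occupied, except for the upper left edge $(0,n+1)\to(1,n)$ and the lower right edge $(n,1)\to(n+1,0)$, and all other boundary edges being empty. At each node the $m$-th uppermost entering step (order North, Northwest, West) is followed by the $m$-th uppermost exiting step (order East, Southeast, South); this decomposes the occupied edges into non-crossing, possibly osculating paths. The weight of a configuration is the product of its node weights. A node with no path has weight $\omega_0$. A node with one path, written (entering, exiting), has weight $\omega_1$ for (N,S), $\omega_2$ for (NW,S) and (N,SE), $\omega_3$ for (NW,SE), $\omega_4$ for (W,S) and (N,E), $\omega_5$ for (W,SE) and (NW,E), $\omega_6$ for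 (W,E). Complementary environments (occupied and empty edges exchanged) have equal weights. Here $$\begin{aligned} \omega_0&=\sin(\lambda+\eta)\sin\tfrac{\lambda+3\eta+\mu}{2}\sin\tfrac{\lambda+3\eta-\mu}{2},& \omega_1&=\sin(\lambda-\eta)\sin\tfrac{\lambda-\eta+\mu}{2}\sin\tfrac{\lambda+3\eta-\mu}{2},\\ \omega_2&=\sin(2\eta)\sin(\lambda-\eta)\sin\tfrac{\lambda+3\eta-\mu}{2},& \omega_3&=\sin^3(2\eta)+\sin(\lambda+\eta)\sin\tfrac{\lambda-\eta+\mu}{2}\sin\tfrac{\lambda-\eta-\mu}{2},\\ \omega_4&=\sin(2\eta)\sin\tfrac{\lambda+3\eta+\mu}{2}\sin\tfrac{\lambda+3\eta-\mu}{2},& \omega_5&=\sin(2\eta)\sin(\lambda-\eta)\sin\tfrac{\lambda+3\eta+\mu}{2},\\ \omega_6&=\sin(\lambda-\eta)\sin\tfrac{\lambda+3\eta+\mu}{2}\sin\tfrac{\lambda-\eta-\mu}{2}. \end{aligned}$$ For $1\le L\le n$ let $\tilde Z^{|}_{n;L}$ (respectively $\tilde Z^{\diagdown}_{n;L}$) be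 the sum of the weights of the configurations whose uppermost path, which starts with the edge $(0,n)\to(1,n)$, leaves the horizontal line $j=n$ at the node $(L,n)$ by a vertical (respectively diagonal) step, and put $$\tilde Z^{|}_n(\tau)=\sum_{L=1}^n\tilde Z^{|}_{n;L}\,\tau^{L-1},\qquad \tilde Z^{\diagdown}_n(\tau)=\sum_{L=1}^n\tilde Z^{\diagdown}_{n;L}\,\tau^{L-1}.$$ **6V model with DWBC.** On the same nodes with the horizontal and vertical edges only, configurations, paths and weights are defined in the same way: left and bottom boundary edges are occupied, right and top ones are empty, as many path steps enter a node as exit it, and a node has weight $a=\sin(\lambda+\eta)$ if it carries no or two paths, $b=\sin(\lambda-\eta)$ if it carries one path going straight, $c=\sin(2\eta)$ if it carries one path that turns. Let $Z^{6V}_{n;L}$ be the sum of the weights of the configurations whose uppermost path hits the vertical line $i=n$ at the node $(n,L)$, and $Z^{6V}_n(\sigma)=\sum_{L=1}^nZ^{6V}_{n;L}\,\sigma^{L-1}$. **Theorem.** Let $q=e^{i\eta}$, $z=e^{i(\eta+\lambda)}$, $w=e^{-i(\eta+\lambda)}$, $t=e^{i\mu}$, $t^{1/3}=e^{i\mu/3}$,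 $\nu=1/(2i\,t^{1/3})$, $a_2=\nu(qz-q^{-1}t)$ and $a_3=\nu(qt-q^{-1}w)$. For every $\sigma\in\mathbb C$ with $$D:=\sigma\sin(\lambda-\eta)\sin\tfrac{\lambda-\eta+\mu}{2}-\sin(\lambda+\eta)\sin\tfrac{\lambda-5\eta+\mu}{2}\neq0,$$ one has $$\tilde Z^{|}_n(\tilde\tau)+\tilde g(\sigma)\,\tilde Z^{\diagdown}_n(\tilde\tau)=\left(\frac{a_2a_3}{t^{1/3}}\right)^{n^2}Z^{6V}_n(\sigma),$$ where $$\tilde\tau=\sigma\,\frac{\sigma\sin(\lambda-\eta)\sin\tfrac{\lambda+3\eta+\mu}{2}-\sin(\lambda+\eta)\sin\tfrac{\lambda-\eta+\mu}{2}}{D}\cdot\frac{\sin\tfrac{\lambda+3\eta-\mu}{2}}{\sin\tfrac{\lambda-\eta-\mu}{2}},\qquad \tilde g(\sigma)=\frac{\sigma\sin(2\eta)\sin\tfrac{\lambda+3\eta-\mu}{2}}{D}.$$ -/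

import Mathlib

/-!  # The 20V and 6V models with domain wall boundary conditions

Nodes of the `n × n` square are pairs `(i, j)` of `Fin n`; the pair `(i, j)` stands for the node with
integer coordinates `(i + 1, j + 1)`, so `i` numbers columns from left to right and `j` numbers rows
from bottom to top.  Configurations are given in the osculating path language: an edge is occupied
(`true`) exactly when it is oriented to the East, South-East or South. -/

namespace TwentyV

/-! ## Edge configurations on the triangular lattice -/

/-- The three directions from which a path step may enter a node, from upper to lower. -/
inductive Inc
  | north
  | northwest
  | west

/-- The three directions in which a path step may exit a node, from upper to lower. -/
inductive Out
  | east
  | southeast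
  | south

/-- Occupation numbers of the edges, as a triple `(h, v, d)` (coordinates below are the integer
coordinates of the nodes, which are `1, …, n`):
* `h k j` is the horizontal edge `(k, j + 1) → (k + 1, j + 1)`, `0 ≤ k ≤ n`;
* `v i l` is the vertical edge `(i + 1, l + 1) → (i + 1, l)`, `0 ≤ l ≤ n`;
* `d k l` is the diagonal edge `(k, l + 1) → (k + 1, l)`, `0 ≤ k, l ≤ n`.
The two slots `d 0 0` and `d n n` are incident to no node of the square: they are not edges, and
are set to `false` in the boundary conditions below. -/
abbrev Config (n : ℕ) : Type :=
  (Fin (n + 1) → Fin n → Bool) × (Fin n → Fin (n + 1) → Bool) × (Fin (n + 1) → Fin (n + 1) → Bool)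

variable {n : ℕ}

/-- Occupation of the edges entering the node `(i, j)`. -/
def inEdge (c : Config n) (i j : Fin n) : Inc → Bool
  | .north => c.2.1 i j.succ
  | .northwest => c.2.2 i.castSucc j.succ
  | .west => c.1 i.castSucc j

/-- Occupation of the edges exiting the node `(i, j)`. -/
def outEdge (c : Config n) (i j : Fin n) : Out → Bool
  | .east => c.1 i.succ j
  | .southeast => c.2.2 i.succ j.castSucc
  | .south => c.2.1 i j.castSucc

/-- The ice rule at `(i, j)`: as many ingoing as outgoing edges, that is, as many path steps enter
the node as exit it. -/
def IceRule (c : Config n) (i j : Fin n) : Prop :=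
  (inEdge c i j .north).toNat + (inEdge c i j .northwest).toNat + (inEdge c i j .west).toNat =
    (outEdge c i j .east).toNat + (outEdge c i j .southeast).toNat + (outEdge c i j .south).toNat

/-- The second domain wall boundary condition (DWBC2): the horizontal and diagonal edges of the left
boundary and the vertical and diagonal edges of the bottom boundary are occupied, except for the
upper left and the lower right diagonal edges; all other boundary edges are empty. -/
structure DWBC2 (c : Config n) : Prop where
  left : ∀ j, c.1 0 j = true
  right : ∀ j, c.1 (Fin.last n) j = false
  bottom : ∀ i, c.2.1 i 0 = true
  top : ∀ i, c.2.1 i (Fin.last n) = false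
  diagLeft : ∀ l, l ≠ 0 → l ≠ Fin.last n → c.2.2 0 l = true
  diagBottom : ∀ k, k ≠ 0 → k ≠ Fin.last n → c.2.2 k 0 = true
  diagTop : ∀ k, c.2.2 k (Fin.last n) = false
  diagRight : ∀ l, c.2.2 (Fin.last n) l = false
  noEdge : c.2.2 0 0 = false

/-- 20V configurations with DWBC2. -/
def IsConfig20V (c : Config n) : Prop :=
  DWBC2 c ∧ ∀ i j, IceRule c i j

/-! ## Paths -/

/-- Number of path steps entering `(i, j)` strictly above the given direction. -/
def inAbove (c : Config n) (i j : Fin n) : Inc → ℕ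
  | .north => 0
  | .northwest => (inEdge c i j .north).toNat
  | .west => (inEdge c i j .north).toNat + (inEdge c i j .northwest).toNat

/-- Number of path steps exiting `(i, j)` strictly above the given direction. -/
def outAbove (c : Config n) (i j : Fin n) : Out → ℕ
  | .east => 0
  | .southeast => (outEdge c i j .east).toNat
  | .south => (outEdge c i j .east).toNat + (outEdge c i j .southeast).toNat

/-- At each node, path steps are concatenated in the unique non-crossing way: the `m`-th uppermost
entering step is followed by the `m`-th uppermost exiting step. -/
def Continues (c : Config n) (i j : Fin n) (a : Inc) (b : Out) : Prop :=
  inEdge c i j a = true ∧ outEdge c i j b = true ∧ inAbove c i j a = outAbove c i j b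

/-- `OnUppermost c i j a`: the uppermost path, which starts with the horizontal edge
`(0, n) → (1, n)`, enters the node `(i, j)` through its edge of direction `a`. -/
inductive OnUppermost (c : Config n) : Fin n → Fin n → Inc → Prop
  | start (i j : Fin n) : i.val = 0 → j.val + 1 = n → OnUppermost c i j .west
  | east (i j i' : Fin n) (a : Inc) : OnUppermost c i j a → Continues c i j a .east →
      i'.val = i.val + 1 → OnUppermost c i' j .west
  | southeast (i j i' j' : Fin n) (a : Inc) : OnUppermost c i j a →
      Continues c i j a .southeast → i'.val = i.val + 1 → j'.val + 1 = j.val →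
      OnUppermost c i' j' .northwest
  | south (i j j' : Fin n) (a : Inc) : OnUppermost c i j a → Continues c i j a .south →
      j'.val + 1 = j.val → OnUppermost c i j' .north

/-- The uppermost path leaves the top horizontal line at the node of column `L`, and the step just
after that node is a vertical one (`b = south`) or a diagonal one (`b = southeast`). -/
def LeavesTop (c : Config n) (L : Fin n) (b : Out) : Prop :=
  b ≠ .east ∧ ∃ (j : Fin n) (a : Inc), j.val + 1 = n ∧ OnUppermost c L j a ∧ Continues c L j a b

/-! ## 20V partition functions -/

/-- The values `ω₀, …, ω₆` of the vertex weights. -/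
noncomputable def omega (η lam μ : ℂ) : Fin 7 → ℂ
  | 0 => Complex.sin (lam + η) * Complex.sin ((lam + 3 * η + μ) / 2) *
      Complex.sin ((lam + 3 * η - μ) / 2)
  | 1 => Complex.sin (lam - η) * Complex.sin ((lam - η + μ) / 2) *
      Complex.sin ((lam + 3 * η - μ) / 2)
  | 2 => Complex.sin (2 * η) * Complex.sin (lam - η) * Complex.sin ((lam + 3 * η - μ) / 2)
  | 3 => Complex.sin (2 * η) ^ 3 + Complex.sin (lam + η) * Complex.sin ((lam - η + μ) / 2) *
      Complex.sin ((lam - η - μ) / 2)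
  | 4 => Complex.sin (2 * η) * Complex.sin ((lam + 3 * η + μ) / 2) *
      Complex.sin ((lam + 3 * η - μ) / 2)
  | 5 => Complex.sin (2 * η) * Complex.sin (lam - η) * Complex.sin ((lam + 3 * η + μ) / 2)
  | 6 => Complex.sin (lam - η) * Complex.sin ((lam + 3 * η + μ) / 2) *
      Complex.sin ((lam - η - μ) / 2)

/-- The weight of a node as a function of the occupation of its edges
`north, northwest, west` (entering) and `east, southeast, south` (exiting): the dictionary from the
20 vertex environments to the seven values `ω₀, …, ω₆`.  (The last case is not an ice environment.) -/
def weight20V (ω : Fin 7 → ℂ) : (N NW W E SE S : Bool) → ℂ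
  -- no path
  | false, false, false, false, false, false => ω 0
  -- one path
  | true, false, false, false, false, true => ω 1
  | true, false, false, false, true, false => ω 2
  | true, false, false, true, false, false => ω 4
  | false, true, false, false, false, true => ω 2
  | false, true, false, false, true, false => ω 3
  | false, true, false, true, false, false => ω 5
  | false, false, true, false, false, true => ω 4
  | false, false, true, false, true, false => ω 5
  | false, false, true, true, false, false => ω 6
  -- two paths (complements of the preceding ones)
  | false, true, true, true, true, false => ω 1
  | false, true, true, true, false, true => ω 2
  | false, true, true, false, true, true => ω 4
  | true, false, true, true, true, false => ω 2
  | true, false, true, true, false, true => ω 3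
  | true, false, true, false, true, true => ω 5
  | true, true, false, true, true, false => ω 4
  | true, true, false, true, false, true => ω 5
  | true, true, false, false, true, true => ω 6
  -- three paths
  | true, true, true, true, true, true => ω 0
  | _, _, _, _, _, _ => 0

/-- The weight of a configuration: the product of the weights of its nodes. -/
def totalWeight20V (ω : Fin 7 → ℂ) (c : Config n) : ℂ :=
  ∏ i : Fin n, ∏ j : Fin n, weight20V ω
    (inEdge c i j .north) (inEdge c i j .northwest) (inEdge c i j .west)
    (outEdge c i j .east) (outEdge c i j .southeast) (outEdge c i j .south)

open Classical in
/-- Partition function of the 20V configurations with DWBC2 whose uppermost path leaves the top line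
in column `L`, with a following step of type `b`. -/
noncomputable def Ztop (n : ℕ) (ω : Fin 7 → ℂ) (b : Out) (L : Fin n) : ℂ :=
  ∑ c : Config n, if IsConfig20V c ∧ LeavesTop c L b then totalWeight20V ω c else 0

/-- The refined partition function: the generating function of `Ztop` with `τ ^ (L - 1)` for the
position `L = 1, …, n`. -/
noncomputable def ZtopRefined (n : ℕ) (ω : Fin 7 → ℂ) (b : Out) (τ : ℂ) : ℂ :=
  ∑ L : Fin n, Ztop n ω b L * τ ^ L.val

/-! ## The 6V model with DWBC -/

/-- Occupation numbers `(h, v)` of the edges of the square grid, with the same conventions as for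
the horizontal and vertical edges of `Config`. -/
abbrev Config6V (n : ℕ) : Type :=
  (Fin (n + 1) → Fin n → Bool) × (Fin n → Fin (n + 1) → Bool)

/-- Whether a path step enters a node of the square grid from the North or from the West. -/
inductive Inc6V
  | north
  | west

/-- Whether a path step exits a node of the square grid to the East or to the South. -/
inductive Out6V
  | east
  | south

/-- Occupation of the edges entering the node `(i, j)`. -/
def inEdge6V (c : Config6V n) (i j : Fin n) : Inc6V → Bool
  | .north => c.2 i j.succ
  | .west => c.1 i.castSucc j

/-- Occupation of the edges exiting the node `(i, j)`. -/
def outEdge6V (c : Config6V n) (i j : Fin n) : Out6V → Bool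
  | .east => c.1 i.succ j
  | .south => c.2 i j.castSucc

/-- 6V configurations with DWBC: the left and bottom boundary edges are occupied, the right and top
ones are empty, and the ice rule holds at each node. -/
structure IsConfig6V (c : Config6V n) : Prop where
  left : ∀ j, c.1 0 j = true
  right : ∀ j, c.1 (Fin.last n) j = false
  bottom : ∀ i, c.2 i 0 = true
  top : ∀ i, c.2 i (Fin.last n) = false
  ice : ∀ i j, (inEdge6V c i j .north).toNat + (inEdge6V c i j .west).toNat =
    (outEdge6V c i j .east).toNat + (outEdge6V c i j .south).toNat

/-- Number of path steps entering `(i, j)` strictly above the given direction. -/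
def inAbove6V (c : Config6V n) (i j : Fin n) : Inc6V → ℕ
  | .north => 0
  | .west => (inEdge6V c i j .north).toNat

/-- Number of path steps exiting `(i, j)` strictly above the given direction. -/
def outAbove6V (c : Config6V n) (i j : Fin n) : Out6V → ℕ
  | .east => 0
  | .south => (outEdge6V c i j .east).toNat

/-- The non-crossing concatenation of path steps at a node of the square grid. -/
def Continues6V (c : Config6V n) (i j : Fin n) (a : Inc6V) (b : Out6V) : Prop :=
  inEdge6V c i j a = true ∧ outEdge6V c i j b = true ∧ inAbove6V c i j a = outAbove6V c i j b

/-- The uppermost path, which starts with the horizontal edge `(0, n) → (1, n)`, enters the node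
`(i, j)` from the direction `a`. -/
inductive OnUppermost6V (c : Config6V n) : Fin n → Fin n → Inc6V → Prop
  | start (i j : Fin n) : i.val = 0 → j.val + 1 = n → OnUppermost6V c i j .west
  | east (i j i' : Fin n) (a : Inc6V) : OnUppermost6V c i j a → Continues6V c i j a .east →
      i'.val = i.val + 1 → OnUppermost6V c i' j .west
  | south (i j j' : Fin n) (a : Inc6V) : OnUppermost6V c i j a → Continues6V c i j a .south →
      j'.val + 1 = j.val → OnUppermost6V c i j' .north

/-- The uppermost path hits the last column at the node of row `L`: it enters this node by a
horizontal step. -/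
def HitsRight6V (c : Config6V n) (L : Fin n) : Prop :=
  ∃ i : Fin n, i.val + 1 = n ∧ OnUppermost6V c i L .west

/-- The weight of a node as a function of the occupation of its edges `north, west` (entering) and
`east, south` (exiting): `a` for no or two paths, `b` for a path going straight, `c` for a path that
turns.  (The last case is not an ice environment.) -/
def weight6V (a b c : ℂ) : (N W E S : Bool) → ℂ
  | false, false, false, false => a
  | true, true, true, true => a
  | true, false, false, true => b
  | false, true, true, false => b
  | true, false, true, false => c
  | false, true, false, true => c
  | _, _, _, _ => 0

open Classical in
/-- Partition function of the 6V configurations with DWBC whose uppermost path hits the last column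
in row `L`. -/
noncomputable def Z6V (n : ℕ) (a b c : ℂ) (L : Fin n) : ℂ :=
  ∑ e : Config6V n, if IsConfig6V e ∧ HitsRight6V e L then
    ∏ i : Fin n, ∏ j : Fin n, weight6V a b c
      (inEdge6V e i j .north) (inEdge6V e i j .west) (outEdge6V e i j .east) (outEdge6V e i j .south)
    else 0

/-- The refined 6V partition function, with `σ ^ (L - 1)` for the position `L = 1, …, n` and with
weights `a = sin (λ + η)`, `b = sin (λ - η)`, `c = sin (2 η)`. -/
noncomputable def Z6VRefined (n : ℕ) (η lam σ : ℂ) : ℂ :=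
  ∑ L : Fin n, Z6V n (Complex.sin (lam + η)) (Complex.sin (lam - η)) (Complex.sin (2 * η)) L *
    σ ^ L.val

/-! ## Parameters -/

/-- The cube root `t^{1/3} = e^{i μ / 3}` of the diagonal spectral parameter `t = e^{i μ}`. -/
noncomputable def tCubeRoot (μ : ℂ) : ℂ := Complex.exp (Complex.I * μ / 3)

/-- The weight `a₂ = ν (q z - q⁻¹ t)` of sub-lattice 2, where `ν = 1 / (2 i t^{1/3})`,
`q = e^{i η}`, `z = e^{i (η + λ)}`, `t = e^{i μ}`. -/
noncomputable def a₂ (η lam μ : ℂ) : ℂ :=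
  1 / (2 * Complex.I * tCubeRoot μ) *
    (Complex.exp (Complex.I * η) * Complex.exp (Complex.I * (η + lam)) -
      (Complex.exp (Complex.I * η))⁻¹ * Complex.exp (Complex.I * μ))

/-- The weight `a₃ = ν (q t - q⁻¹ w)` of sub-lattice 3, where `w = e^{-i (η + λ)}`. -/
noncomputable def a₃ (η lam μ : ℂ) : ℂ :=
  1 / (2 * Complex.I * tCubeRoot μ) *
    (Complex.exp (Complex.I * η) * Complex.exp (Complex.I * μ) -
      (Complex.exp (Complex.I * η))⁻¹ * Complex.exp (-(Complex.I * (η + lam))))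

/-- The common denominator of `τ̃` and `g̃`. -/
noncomputable def denomTilde (η lam μ σ : ℂ) : ℂ :=
  σ * Complex.sin (lam - η) * Complex.sin ((lam - η + μ) / 2) -
    Complex.sin (lam + η) * Complex.sin ((lam - 5 * η + μ) / 2)

/-- The argument `τ̃` as a function of `σ`. -/
noncomputable def tauTilde (η lam μ σ : ℂ) : ℂ :=
  σ * ((σ * Complex.sin (lam - η) * Complex.sin ((lam + 3 * η + μ) / 2) -
      Complex.sin (lam + η) * Complex.sin ((lam - η + μ) / 2)) / denomTilde η lam μ σ) *
    (Complex.sin ((lam + 3 * η - μ) / 2) / Complex.sin ((lam - η - μ) / 2))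

/-- The prefactor `g̃` as a function of `σ`. -/
noncomputable def gTilde (η lam μ σ : ℂ) : ℂ :=
  σ * Complex.sin (2 * η) * Complex.sin ((lam + 3 * η - μ) / 2) / denomTilde η lam μ σ

end TwentyV

/-! Resolve every node of the triangular lattice into a small triangle formed by a horizontal, a
vertical and a diagonal line. The values ω₀, …, ω₆ are exactly the weights of three six-vertex
crossings with the same anisotropy k = cos 2η (`triangleUpper_eq_weight20V`): weights (a1, b1) for
horizontal-vertical, (a2, b2) for horizontal-diagonal, (a3, b3) for diagonal-vertical, and a common
turning weight s = sin 2η. The Yang-Baxter equation (`yangBaxter`) then lets a diagonal slide across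
any horizontal-vertical crossing. Diagonals e ≥ 0 enter and leave empty and are pushed to the upper
right corner, where all lines are empty; diagonals e < 0 enter and leave occupied and are pushed to
the lower left corner, where all lines are occupied. There their crossings are frozen with weights
a2 and a3. What remains is the 6V model, times (a2 a3)^(n²), since each node contributes one
crossing of each kind (`gridProd_tripleOp`, `sum_triangle_eq_sum_six`).

The refinement comes from changing the parameter of the top horizontal line alone. After
normalization and gauge this keeps a1 and the horizontal-to-vertical turning weight s, and replaces
b1 by σ b1 and (a2, b2) by (α, β). Nothing enters the top row from above, so on the 6V side its path
gains σ per straight step. On the 20V side each (W,E) node gains τ̃ = σβa2/(b2α), and the leaving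
node gains 1 if the step is vertical and g̃ = σa2/α if it is diagonal (`prod_triangle_eq`). Only
algebraic relations between the weights are used, so σ is an arbitrary complex number with α ≠ 0,
that is D ≠ 0. The 6V side is refined along the top row, while `Z6V` is refined along the last
column; a reflection in the diagonal connects them.

Crossings are operators on functions of the line states, (T f)(x) = Σ weight(x → y) f(y). A product
read from left to right therefore scans the lattice from the upper left to the lower right, and a
partition function is a matrix element between `inState` and `outState`. -/

namespace TwentyV

/-! ### Ordered products over an array, and sliding a line across it. -/

section OrderedProducts

variable {M : Type*} [Monoid M]

/-- The ordered product `f a * f (a + 1) * ⋯ * f (a + m - 1)`. -/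
def oprod (f : ℕ → M) : ℕ → ℕ → M
  | _, 0 => 1
  | a, m + 1 => f a * oprod f (a + 1) m

@[simp] theorem oprod_zero (f : ℕ → M) (a : ℕ) : oprod f a 0 = 1 := rfl

theorem oprod_succ_left (f : ℕ → M) (a m : ℕ) :
    oprod f a (m + 1) = f a * oprod f (a + 1) m := rfl

theorem oprod_add (f : ℕ → M) (a m k : ℕ) :
    oprod f a (m + k) = oprod f a m * oprod f (a + m) k := by
  induction m generalizing a with
  | zero => simp
  | succ m ih =>
    rw [show m + 1 + k = (m + k) + 1 by omega, oprod_succ_left, oprod_succ_left, ih, mul_assoc,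
      show a + 1 + m = a + (m + 1) by omega]

theorem oprod_succ_right (f : ℕ → M) (a m : ℕ) :
    oprod f a (m + 1) = oprod f a m * f (a + m) := by
  rw [oprod_add, oprod_succ_left, oprod_zero, mul_one]

theorem oprod_congr {f g : ℕ → M} {a m : ℕ} (h : ∀ i, a ≤ i → i < a + m → f i = g i) :
    oprod f a m = oprod g a m := by
  induction m generalizing a with
  | zero => rfl
  | succ m ih =>
    rw [oprod_succ_left, oprod_succ_left, h a le_rfl (by omega),
      ih fun i h1 h2 => h i (by omega) (by omega)]

theorem commute_oprod {f : ℕ → M} {x : M} {a m : ℕ}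
    (h : ∀ i, a ≤ i → i < a + m → Commute x (f i)) : Commute x (oprod f a m) := by
  induction m generalizing a with
  | zero => exact Commute.one_right x
  | succ m ih =>
    exact (h a le_rfl (by omega)).mul_right (ih fun i h1 h2 => h i (by omega) (by omega))

/-- The product of the elements of an `n × n` array, row after row. -/
def gridProd (n : ℕ) (A : ℕ → ℕ → M) : M :=
  oprod (fun r => oprod (fun i => A i r) 0 n) 0 n

theorem gridProd_congr {n : ℕ} {A B : ℕ → ℕ → M} (h : ∀ i r, i < n → r < n → A i r = B i r) :
    gridProd n A = gridProd n B :=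
  oprod_congr fun r _ hr => oprod_congr fun i _ hi => h i r (by omega) (by omega)

/-- The crossing `y` travels through the row one node at a time. Each exchange consumes the factor
`w i` of that column, which can be brought next to `A i` because it commutes with the nodes of the
other columns. -/
theorem flip_right {A : ℕ → M} {w : ℕ → M} {y : M} (a m : ℕ)
    (hf : ∀ i, a ≤ i → y * A i * w i = w i * A i * y)
    (hw : ∀ i i', i ≠ i' → Commute (w i) (A i')) :
    y * oprod A a m * oprod w a m = oprod w a m * oprod A a m * y := by
  induction m generalizing a with
  | zero => simp
  | succ m ih =>
    have h1 : Commute (w a) (oprod A (a + 1) m) :=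
      commute_oprod fun i hi _ => hw a i (by omega)
    have h2 : Commute (A a) (oprod w (a + 1) m) :=
      commute_oprod fun i hi _ => (hw i a (by omega)).symm
    simp only [oprod_succ_left]
    calc y * (A a * oprod A (a + 1) m) * (w a * oprod w (a + 1) m)
        = y * A a * (oprod A (a + 1) m * w a) * oprod w (a + 1) m := by simp only [mul_assoc]
      _ = (y * A a * w a) * oprod A (a + 1) m * oprod w (a + 1) m := by
          rw [← h1.eq]; simp only [mul_assoc]
      _ = w a * A a * (y * oprod A (a + 1) m * oprod w (a + 1) m) := by
          rw [hf a le_rfl]; simp only [mul_assoc]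
      _ = w a * (A a * oprod w (a + 1) m) * oprod A (a + 1) m * y := by
          rw [ih (a + 1) fun i hi => hf i (by omega)]; simp only [mul_assoc]
      _ = w a * oprod w (a + 1) m * (A a * oprod A (a + 1) m) * y := by
          rw [h2.eq]; simp only [mul_assoc]

/-- Mirror image of `flip_right`: here `y` travels from the end of the row to its beginning, so the
induction peels off the last column. -/
theorem flip_left {A : ℕ → M} {w : ℕ → M} {y : M} (m : ℕ)
    (hf : ∀ i, i < m → w i * A i * y = y * A i * w i)
    (hw : ∀ i i', i ≠ i' → Commute (w i) (A i')) :
    oprod w 0 m * (oprod A 0 m * y) = y * oprod A 0 m * oprod w 0 m := by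
  induction m with
  | zero => simp
  | succ m ih =>
    have h1 : Commute (w m) (oprod A 0 m) := commute_oprod fun i _ hi => hw m i (by omega)
    have h2 : Commute (A m) (oprod w 0 m) := commute_oprod fun i _ hi => (hw i m (by omega)).symm
    simp only [oprod_succ_right, Nat.zero_add]
    calc oprod w 0 m * w m * (oprod A 0 m * A m * y)
        = oprod w 0 m * (w m * oprod A 0 m) * (A m * y) := by simp only [mul_assoc]
      _ = oprod w 0 m * oprod A 0 m * (w m * A m * y) := by rw [h1.eq]; simp only [mul_assoc]
      _ = oprod w 0 m * (oprod A 0 m * y) * A m * w m := by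
          rw [hf m (by omega)]; simp only [mul_assoc]
      _ = y * oprod A 0 m * (oprod w 0 m * A m) * w m := by
          rw [ih fun i hi => hf i (by omega)]; simp only [mul_assoc]
      _ = y * (oprod A 0 m * A m) * (oprod w 0 m * w m) := by
          rw [← h2.eq]; simp only [mul_assoc]

/-- A line crossing the array along `i = r + e` can be moved to the upper right of the array. -/
theorem push_upper {n e : ℕ} (he : e ≤ n) (A : ℕ → ℕ → M) (w y : ℕ → M)
    (hf : ∀ i r, r + e < i → y r * A i r * w i = w i * A i r * y r)
    (hw : ∀ i i' r, i ≠ i' → Commute (w i) (A i' r))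
    (hy : ∀ i r r', r ≠ r' → Commute (y r) (A i r')) :
    gridProd n (fun i r => if i = r + e then w i * A i r * y r else A i r) =
      oprod w e (n - e) * gridProd n A * oprod y 0 (n - e) := by
  set B : ℕ → ℕ → M := fun i r => if i = r + e then w i * A i r * y r else A i r with hB
  set rowA : ℕ → M := fun r => oprod (fun i => A i r) 0 n with hrowA
  set rowB : ℕ → M := fun r => oprod (fun i => B i r) 0 n with hrowB
  -- One row of the move: the vertical crossings already lifted out of the lower rows pass above row
  -- `r` and are joined by `w (r + e)`, while `y r` goes to the right end of the row.
  have hrow : ∀ r m, r + e + m + 1 = n →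
      rowB r * oprod w (r + e + 1) m = oprod w (r + e) (m + 1) * rowA r * y r := by
    intro r m hm
    have hsplit : ∀ C : ℕ → ℕ → M, oprod (fun i => C i r) 0 n =
        oprod (fun i => C i r) 0 (r + e) * C (r + e) r * oprod (fun i => C i r) (r + e + 1) m := by
      intro C
      conv_lhs => rw [show n = (r + e) + (m + 1) by omega]
      rw [oprod_add, oprod_succ_left, Nat.zero_add, mul_assoc]
    have hl : oprod (fun i => B i r) 0 (r + e) = oprod (fun i => A i r) 0 (r + e) :=
      oprod_congr fun i _ hi => by simp [hB, show i ≠ r + e by omega]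
    have hr : oprod (fun i => B i r) (r + e + 1) m = oprod (fun i => A i r) (r + e + 1) m :=
      oprod_congr fun i hi _ => by simp [hB, show i ≠ r + e by omega]
    have hc : B (r + e) r = w (r + e) * A (r + e) r * y r := by simp [hB]
    have h1 := flip_right (A := fun i => A i r) (w := w) (y := y r) (r + e + 1) m
      (fun i hi => hf i r (by omega)) (fun i i' h => hw i i' r h)
    have h2 : Commute (oprod w (r + e) (m + 1)) (oprod (fun i => A i r) 0 (r + e)) :=
      commute_oprod fun i _ hi => (commute_oprod fun j hj _ => (hw j i r (by omega)).symm).symm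
    have h3 : Commute (A (r + e) r) (oprod w (r + e + 1) m) :=
      commute_oprod fun j hj _ => (hw j _ r (by omega)).symm
    simp only [hrowA, hrowB]
    rw [hsplit B, hsplit A, hl, hr, hc]
    generalize oprod (fun i => A i r) 0 (r + e) = P at *
    generalize oprod (fun i => A i r) (r + e + 1) m = Q at *
    rw [oprod_succ_left] at h2 ⊢
    generalize oprod w (r + e + 1) m = V at *
    calc P * (w (r + e) * A (r + e) r * y r) * Q * V
        = P * w (r + e) * A (r + e) r * (y r * Q * V) := by simp only [mul_assoc]
      _ = P * w (r + e) * (A (r + e) r * V) * Q * y r := by rw [h1]; simp only [mul_assoc]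
      _ = (P * (w (r + e) * V)) * A (r + e) r * Q * y r := by rw [h3.eq]; simp only [mul_assoc]
      _ = _ := by rw [← h2.eq]; simp only [mul_assoc]
  -- Here `m` counts the rows from `r` on that the line crosses inside the array; the last `e` rows
  -- are not crossed and form the base case.
  have key : ∀ m r, r + m + e = n →
      oprod rowB r (m + e) = oprod w (r + e) m * oprod rowA r (m + e) * oprod y r m := by
    intro m
    induction m with
    | zero =>
      intro r hr
      simp only [Nat.zero_add, oprod_zero, one_mul, mul_one]
      refine oprod_congr fun r' hr' hr'' => oprod_congr fun i _ hi => ?_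
      simp [hB, show i ≠ r' + e by omega]
    | succ m ih =>
      intro r hr
      have hc : Commute (y r) (oprod rowA (r + 1) (m + e)) :=
        commute_oprod fun r' h1 _ => commute_oprod fun i _ _ => hy i r r' (by omega)
      rw [show m + 1 + e = (m + e) + 1 by omega, oprod_succ_left, ih (r + 1) (by omega),
        oprod_succ_left rowA, oprod_succ_left y, show r + 1 + e = r + e + 1 by omega]
      calc _ = rowB r * oprod w (r + e + 1) m * oprod rowA (r + 1) (m + e) * oprod y (r + 1) m := by
            simp only [mul_assoc]
        _ = oprod w (r + e) (m + 1) * rowA r * (y r * oprod rowA (r + 1) (m + e)) *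
              oprod y (r + 1) m := by
            rw [hrow r m (by omega)]; simp only [mul_assoc]
        _ = _ := by rw [hc.eq]; simp only [mul_assoc]
  have := key (n - e) 0 (by omega)
  rw [Nat.sub_add_cancel he, Nat.zero_add] at this
  exact this

/-- A line crossing the array along `r = i + e` can be moved to the lower left of the array. -/
theorem push_lower {n e : ℕ} (he : e ≤ n) (A : ℕ → ℕ → M) (w y : ℕ → M)
    (hf : ∀ i r, i + e < r → w i * A i r * y r = y r * A i r * w i)
    (hw : ∀ i i' r, i ≠ i' → Commute (w i) (A i' r))
    (hy : ∀ i r r', r ≠ r' → Commute (y r) (A i r')) :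
    gridProd n (fun i r => if r = i + e then y r * A i r * w i else A i r) =
      oprod y e (n - e) * gridProd n A * oprod w 0 (n - e) := by
  set B : ℕ → ℕ → M := fun i r => if r = i + e then y r * A i r * w i else A i r with hB
  set rowA : ℕ → M := fun r => oprod (fun i => A i r) 0 n with hrowA
  set rowB : ℕ → M := fun r => oprod (fun i => B i r) 0 n with hrowB
  have hrow : ∀ m, e + m < n →
      oprod w 0 m * rowB (e + m) = y (e + m) * rowA (e + m) * oprod w 0 (m + 1) := by
    intro m hm
    set r := e + m with hr
    have hsplit : ∀ C : ℕ → ℕ → M, oprod (fun i => C i r) 0 n =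
        oprod (fun i => C i r) 0 m * C m r * oprod (fun i => C i r) (m + 1) (n - m - 1) := by
      intro C
      conv_lhs => rw [show n = m + ((n - m - 1) + 1) by omega]
      rw [oprod_add, oprod_succ_left, Nat.zero_add, mul_assoc]
    have hl : oprod (fun i => B i r) 0 m = oprod (fun i => A i r) 0 m :=
      oprod_congr fun i _ hi => by simp [hB, show r ≠ i + e by omega]
    have hr' : oprod (fun i => B i r) (m + 1) (n - m - 1) =
        oprod (fun i => A i r) (m + 1) (n - m - 1) :=
      oprod_congr fun i hi _ => by simp [hB, show r ≠ i + e by omega]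
    have hc : B m r = y r * A m r * w m := by simp [hB, show r = m + e by omega]
    have h1 := flip_left (A := fun i => A i r) (w := w) (y := y r) m
      (fun i hi => hf i r (by omega)) (fun i i' h => hw i i' r h)
    have h2 : Commute (oprod w 0 (m + 1)) (oprod (fun i => A i r) (m + 1) (n - m - 1)) :=
      commute_oprod fun i _ hi => (commute_oprod fun j hj _ => (hw j i r (by omega)).symm).symm
    have h3 : Commute (A m r) (oprod w 0 m) :=
      commute_oprod fun j hj _ => (hw j _ r (by omega)).symm
    simp only [hrowA, hrowB]
    rw [hsplit B, hsplit A, hl, hr', hc]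
    generalize oprod (fun i => A i r) 0 m = P at *
    generalize oprod (fun i => A i r) (m + 1) (n - m - 1) = Q at *
    rw [oprod_succ_right, Nat.zero_add] at h2 ⊢
    generalize oprod w 0 m = V at *
    calc V * (P * (y r * A m r * w m) * Q)
        = V * (P * y r) * A m r * w m * Q := by simp only [mul_assoc]
      _ = y r * P * (V * A m r) * w m * Q := by rw [h1]; simp only [mul_assoc]
      _ = y r * P * A m r * (V * w m * Q) := by rw [← h3.eq]; simp only [mul_assoc]
      _ = _ := by rw [h2.eq]; simp only [mul_assoc]
  -- The first `e` rows are not crossed by the line; the induction adds further rows at the bottom.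
  have key : ∀ m, e + m ≤ n →
      oprod rowB 0 (e + m) = oprod y e m * oprod rowA 0 (e + m) * oprod w 0 m := by
    intro m
    induction m with
    | zero =>
      intro hr
      simp only [Nat.add_zero, oprod_zero, one_mul, mul_one]
      refine oprod_congr fun r' hr' hr'' => oprod_congr fun i _ hi => ?_
      simp [hB, show r' ≠ i + e by omega]
    | succ m ih =>
      intro hr
      have hc : Commute (y (e + m)) (oprod rowA 0 (e + m)) :=
        commute_oprod fun r' h1 _ => commute_oprod fun i _ _ => hy i _ r' (by omega)
      rw [show e + (m + 1) = (e + m) + 1 by omega, oprod_succ_right, ih (by omega),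
        oprod_succ_right rowA, oprod_succ_right y, Nat.zero_add]
      calc _ = oprod y e m * oprod rowA 0 (e + m) * (oprod w 0 m * rowB (e + m)) := by
            simp only [mul_assoc]
        _ = oprod y e m * (oprod rowA 0 (e + m) * y (e + m)) * rowA (e + m) *
              oprod w 0 (m + 1) := by
            rw [hrow m (by omega)]; simp only [mul_assoc]
        _ = _ := by rw [← hc.eq]; simp only [mul_assoc]
  have := key (n - e) (by omega)
  rw [show e + (n - e) = n by omega] at this
  exact this

end OrderedProducts

/-! ## Vertex operators on line states -/

/-- The horizontal lines (numbered from the top), the vertical lines (from the left), and the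
diagonal lines (by the column minus the row from the top). -/
inductive Line
  | horiz (r : ℕ)
  | vert (i : ℕ)
  | diag (e : ℤ)

noncomputable instance : DecidableEq Line := Classical.decEq _

/-- Occupation of all lines along a cut of the lattice. -/
abbrev LineState : Type := Line → Bool

/-- Vertex operators act on functions of the line states. -/
abbrev LineOp : Type := Module.End ℂ (LineState → ℂ)

/-- The operator of the crossing of the lines `a` and `b`, with weights `m`. -/
noncomputable def pairOp (m : Bool → Bool → Bool → Bool → ℂ) (a b : Line) : LineOp where
  toFun f x := ∑ p, ∑ q, m (x a) (x b) p q * f (Function.update (Function.update x a p) b q)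
  map_add' f g := by
    funext x
    simp only [Pi.add_apply, mul_add, Finset.sum_add_distrib]
  map_smul' k f := by
    funext x
    simp only [Pi.smul_apply, smul_eq_mul, Finset.mul_sum, RingHom.id_apply]
    exact Finset.sum_congr rfl fun p _ => Finset.sum_congr rfl fun q _ => by ring

/-- The operator of a triple crossing, with weights `M`. -/
noncomputable def nodeOp (M : Bool → Bool → Bool → Bool → Bool → Bool → ℂ) (a b c : Line) : LineOp where
  toFun f x := ∑ o : Bool × Bool × Bool, M (x a) (x b) (x c) o.1 o.2.1 o.2.2 *
    f (Function.update (Function.update (Function.update x a o.1) b o.2.1) c o.2.2)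
  map_add' f g := by
    funext x
    simp only [Pi.add_apply, mul_add, Finset.sum_add_distrib]
  map_smul' k f := by
    funext x
    simp only [Pi.smul_apply, smul_eq_mul, Finset.mul_sum, RingHom.id_apply]
    exact Finset.sum_congr rfl fun p _ => by ring

theorem pairOp_apply (m : Bool → Bool → Bool → Bool → ℂ) (a b : Line) (f : LineState → ℂ)
    (x : LineState) : pairOp m a b f x =
      ∑ p, ∑ q, m (x a) (x b) p q * f (Function.update (Function.update x a p) b q) := rfl

theorem nodeOp_apply (M : Bool → Bool → Bool → Bool → Bool → Bool → ℂ) (a b c : Line)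
    (f : LineState → ℂ) (x : LineState) : nodeOp M a b c f x =
      ∑ o : Bool × Bool × Bool, M (x a) (x b) (x c) o.1 o.2.1 o.2.2 *
        f (Function.update (Function.update (Function.update x a o.1) b o.2.1) c o.2.2) := rfl

theorem commute_pairOp (m m' : Bool → Bool → Bool → Bool → ℂ) {a b c d : Line}
    (hac : a ≠ c) (had : a ≠ d) (hbc : b ≠ c) (hbd : b ≠ d) :
    Commute (pairOp m a b) (pairOp m' c d) := by
  refine LinearMap.ext fun f => funext fun x => ?_
  simp only [Module.End.mul_apply, pairOp_apply, Fintype.sum_bool, Function.update_of_ne hac,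
    Function.update_of_ne had, Function.update_of_ne hbc, Function.update_of_ne hbd,
    Function.update_of_ne hac.symm, Function.update_of_ne had.symm,
    Function.update_of_ne hbc.symm, Function.update_of_ne hbd.symm]
  have hx : ∀ p q p' q', Function.update (Function.update (Function.update (Function.update x c p')
      d q') a p) b q = Function.update (Function.update (Function.update (Function.update x a p)
      b q) c p') d q' := by
    intro p q p' q'
    rw [Function.update_comm had.symm, Function.update_comm hac.symm,
      Function.update_comm hbd.symm, Function.update_comm hbc.symm]
  simp only [hx]
  ring

/-- Freezing on the entering side: only the weights out of the local state of `x` matter. On the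
exiting side, `pairOp_stateIndicator` uses the weights into the local state of `y`. -/
theorem pairOp_apply_of_fixed {m : Bool → Bool → Bool → Bool → ℂ} {a b : Line} {x : LineState}
    (hm : ∀ p q, m (x a) (x b) p q = if p = x a ∧ q = x b then 1 else 0) (f : LineState → ℂ) :
    pairOp m a b f x = f x := by
  rw [pairOp_apply, Fintype.sum_eq_single (x a), Fintype.sum_eq_single (x b)]
  · simp [hm]
  · intro q hq
    simp [hm, hq]
  · intro p hp
    simp [hm, hp]

open Classical in
/-- The indicator function of a line state. -/
noncomputable def stateIndicator (y : LineState) : LineState → ℂ := fun x => if x = y then 1 else 0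

theorem pairOp_stateIndicator {m : Bool → Bool → Bool → Bool → ℂ} {a b : Line} (hab : a ≠ b)
    {y : LineState}
    (hm : ∀ p q, m p q (y a) (y b) = if p = y a ∧ q = y b then 1 else 0) :
    pairOp m a b (stateIndicator y) = stateIndicator y := by
  funext x
  rw [pairOp_apply, Fintype.sum_eq_single (y a), Fintype.sum_eq_single (y b), hm]
  · by_cases h : x a = y a ∧ x b = y b
    · rw [if_pos h, ← h.1, ← h.2]
      simp
    · rw [if_neg h, zero_mul, stateIndicator, if_neg]
      rintro rfl
      exact h ⟨rfl, rfl⟩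
  · intro q hq
    rw [stateIndicator, if_neg, mul_zero]
    intro h
    exact hq (by simpa using congrFun h b)
  · intro p hp
    refine Finset.sum_eq_zero fun q _ => ?_
    rw [stateIndicator, if_neg, mul_zero]
    intro h
    exact hp (by simpa [hab] using congrFun h a)

/-- The weights of the triangle where the diagonal passes to the upper right of the crossing of the
two other lines. -/
def triangleUpper (mX mY mW : Bool → Bool → Bool → Bool → ℂ) (h v d p q u : Bool) : ℂ :=
  ∑ d₁, ∑ v₁, ∑ h₁, mW d v d₁ v₁ * mX h v₁ h₁ q * mY h₁ d₁ p u

/-- The weights of the triangle where the diagonal passes to the lower left of the crossing of the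
two other lines. -/
def triangleLower (mX mY mW : Bool → Bool → Bool → Bool → ℂ) (h v d p q u : Bool) : ℂ :=
  ∑ h', ∑ d', ∑ v', mY h d h' d' * mX h' v p v' * mW d' v' u q

theorem pairOp_mul_upper (mX mY mW : Bool → Bool → Bool → Bool → ℂ) {a b c : Line} (hab : a ≠ b)
    (hac : a ≠ c) (hbc : b ≠ c) :
    pairOp mW c b * pairOp mX a b * pairOp mY a c = nodeOp (triangleUpper mX mY mW) a b c := by
  refine LinearMap.ext fun f => funext fun x => ?_
  have hx : ∀ d' v' h' q p u, Function.update (Function.update (Function.update (Function.update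
      (Function.update (Function.update x c d') b v') a h') b q) a p) c u =
      Function.update (Function.update (Function.update x a p) b q) c u := by
    intro d' v' h' q p u
    funext l
    by_cases h1 : l = c
    · simp [h1]
    · by_cases h2 : l = b
      · simp [h2, hbc, hab.symm]
      · by_cases h3 : l = a
        · simp [h3, hac, hab]
        · simp [h1, h2, h3]
  simp only [Module.End.mul_apply, pairOp_apply, nodeOp_apply, triangleUpper, hx,
    Function.update_self, Function.update_of_ne hab, Function.update_of_ne hac,
    Function.update_of_ne hac.symm,
    Function.update_of_ne hbc.symm, Fintype.sum_prod_type, Fintype.sum_bool]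
  ring

theorem pairOp_mul_lower (mX mY mW : Bool → Bool → Bool → Bool → ℂ) {a b c : Line} (hab : a ≠ b)
    (hac : a ≠ c) (hbc : b ≠ c) :
    pairOp mY a c * pairOp mX a b * pairOp mW c b = nodeOp (triangleLower mX mY mW) a b c := by
  refine LinearMap.ext fun f => funext fun x => ?_
  have hx : ∀ h' d' p v' u q, Function.update (Function.update (Function.update (Function.update
      (Function.update (Function.update x a h') c d') a p) b v') c u) b q =
      Function.update (Function.update (Function.update x a p) b q) c u := by
    intro d' v' h' q p u
    funext l
    by_cases h1 : l = c
    · simp [h1, hbc.symm]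
    · by_cases h2 : l = b
      · simp [h2, hbc]
      · by_cases h3 : l = a
        · simp [h3, hac, hab]
        · simp [h1, h2, h3]
  simp only [Module.End.mul_apply, pairOp_apply, nodeOp_apply, triangleLower, hx,
    Function.update_self, Function.update_of_ne hac,
    Function.update_of_ne hbc, Function.update_of_ne hab.symm, Function.update_of_ne hac.symm,
    Function.update_of_ne hbc.symm, Fintype.sum_prod_type, Fintype.sum_bool]
  ring

/-- A double crossing is treated as a triple one with a spectator diagonal, so that a single
expansion into configurations serves both models. -/
theorem pairOp_eq_nodeOp (m : Bool → Bool → Bool → Bool → ℂ) {a b c : Line}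
    (hac : a ≠ c) (hbc : b ≠ c) :
    pairOp m a b = nodeOp (fun h v d p q u => if u = d then m h v p q else 0) a b c := by
  refine LinearMap.ext fun f => funext fun x => ?_
  have hx : ∀ p q, Function.update (Function.update (Function.update x a p) b q) c (x c) =
      Function.update (Function.update x a p) b q := by
    intro p q
    rw [Function.update_eq_self_iff, Function.update_of_ne hbc.symm, Function.update_of_ne hac.symm]
  simp only [pairOp_apply, nodeOp_apply, Fintype.sum_prod_type]
  refine Finset.sum_congr rfl fun p _ => Finset.sum_congr rfl fun q _ => ?_
  rw [Fintype.sum_eq_single (x c)]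
  · simp [hx]
  · intro u hu
    simp [hu]

/-- Six-vertex weights: `a` for no or two paths, `b` for a path that goes straight, `cp` for a path
that turns from the first line to the second one, `cm` for a path that turns from the second line
to the first one. -/
def sixWeight (a b cp cm : ℂ) : Bool → Bool → Bool → Bool → ℂ
  | false, false, false, false => a
  | true, true, true, true => a
  | true, false, true, false => b
  | false, true, false, true => b
  | true, false, false, true => cp
  | false, true, true, false => cm
  | _, _, _, _ => 0

-- The constant `k` is the anisotropy shared by the crossings; `ha2` and `hb2` determine the
-- horizontal-diagonal weights from the other two kinds. The two turning weights `s` and `cm` of the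
-- horizontal line may differ, only their product entering the anisotropy relation `hcm`. The cases
-- that are not immediate are multiples of the three star-triangle relations `e1`, `e2`, `hb2`.
set_option maxHeartbeats 1000000 in
theorem yangBaxter {s k a3 b3 A B a2 b2 cm : ℂ} (hs : s ≠ 0)
    (h3 : a3 ^ 2 + b3 ^ 2 - 2 * k * a3 * b3 = s ^ 2)
    (ha2 : s * a2 = B * b3 - A * (2 * k * b3 - a3)) (hb2 : s * b2 = B * a3 - A * b3)
    (hcm : s * cm = A ^ 2 + B ^ 2 - 2 * k * A * B) (h v d p q u : Bool) :
    triangleUpper (sixWeight A B s cm) (sixWeight a2 b2 s cm) (sixWeight a3 b3 s s) h v d p q u =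
    triangleLower (sixWeight A B s cm) (sixWeight a2 b2 s cm) (sixWeight a3 b3 s s) h v d p q u := by
  have e1 : B * a2 = A * b2 + cm * b3 := by
    refine mul_left_cancel₀ hs ?_
    linear_combination B * ha2 - A * hb2 - b3 * hcm
  have e2 : s * A + b3 * b2 = a2 * a3 := by
    refine mul_left_cancel₀ hs ?_
    linear_combination b3 * hb2 - a3 * ha2 - A * h3
  cases h <;> cases v <;> cases d <;> cases p <;> cases q <;> cases u <;>
    simp only [triangleUpper, triangleLower, Fintype.sum_bool, sixWeight, mul_zero, zero_mul,
      add_zero, zero_add]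
  all_goals try ring1
  all_goals first
    | linear_combination s * e1
    | linear_combination (-s) * e1
    | linear_combination s * e2
    | linear_combination (-s) * e2
    | linear_combination cm * e2
    | linear_combination (-cm) * e2
    | linear_combination s * hb2
    | linear_combination (-s) * hb2
    | linear_combination cm * hb2
    | linear_combination (-cm) * hb2

/-! ## Removing the diagonal lines -/

/-- Vertex weights for which crossings of two empty or of two occupied lines are trivial. -/
def IsFrozen (m : Bool → Bool → Bool → Bool → ℂ) : Prop :=
  ∀ s p q, m s s p q = (if p = s ∧ q = s then 1 else 0) ∧
    m p q s s = (if p = s ∧ q = s then 1 else 0)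

theorem isFrozen_sixWeight (b cp cm : ℂ) : IsFrozen (sixWeight 1 b cp cm) := by
  intro s p q
  cases s <;> cases p <;> cases q <;> simp [sixWeight]

theorem oprod_apply_eq_of_fixed {f : ℕ → LineOp} {a m : ℕ} {g : LineState → ℂ}
    (h : ∀ i, a ≤ i → i < a + m → f i g = g) : oprod f a m g = g := by
  induction m generalizing a with
  | zero => rfl
  | succ m ih =>
    rw [oprod_succ_left, Module.End.mul_apply, ih fun i h1 h2 => h i (by omega) (by omega),
      h a le_rfl (by omega)]

theorem oprod_apply_apply_eq_of_fixed {f : ℕ → LineOp} {a m : ℕ} {x : LineState}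
    (h : ∀ i, a ≤ i → i < a + m → ∀ g, f i g x = g x) (g : LineState → ℂ) :
    oprod f a m g x = g x := by
  induction m generalizing a with
  | zero => rfl
  | succ m ih =>
    rw [oprod_succ_left, Module.End.mul_apply, h a le_rfl (by omega),
      ih fun i h1 h2 => h i (by omega) (by omega)]

/-- The operator of the crossing of column `i` and row `r`. -/
noncomputable def crossOp (mX : ℕ → Bool → Bool → Bool → Bool → ℂ) (i r : ℕ) : LineOp :=
  pairOp (mX r) (.horiz r) (.vert i)

/-- The operator of the crossing of row `r` and the diagonal `e`. -/
noncomputable def horizDiagOp (mY : ℕ → Bool → Bool → Bool → Bool → ℂ) (e : ℤ) (r : ℕ) : LineOp :=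
  pairOp (mY r) (.horiz r) (.diag e)

/-- The operator of the crossing of the diagonal `e` and column `i`. -/
noncomputable def diagVertOp (mW : Bool → Bool → Bool → Bool → ℂ) (e : ℤ) (i : ℕ) : LineOp :=
  pairOp mW (.diag e) (.vert i)

/-- The operator of the triple crossing in column `i` and row `r`. -/
noncomputable def tripleOp (mX mY : ℕ → Bool → Bool → Bool → Bool → ℂ) (mW : Bool → Bool → Bool → Bool → ℂ)
    (i r : ℕ) : LineOp :=
  diagVertOp mW (i - r) i * crossOp mX i r * horizDiagOp mY (i - r) r

/-- The line state on the upper left of the square for the domain wall boundary condition. -/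
def inState (n : ℕ) : LineState
  | .horiz r => decide (r < n)
  | .vert _ => false
  | .diag e => decide (-(n : ℤ) < e ∧ e < 0)

/-- The line state on the lower right of the square for the domain wall boundary condition. -/
def outState (n : ℕ) : LineState
  | .horiz _ => false
  | .vert i => decide (i < n)
  | .diag e => decide (-(n : ℤ) < e ∧ e < 0)

variable {mX mY : ℕ → Bool → Bool → Bool → Bool → ℂ} {mW : Bool → Bool → Bool → Bool → ℂ}

theorem tripleOp_eq_nodeOp (i r : ℕ) : tripleOp mX mY mW i r =
    nodeOp (triangleUpper (mX r) (mY r) mW) (.horiz r) (.vert i) (.diag (i - r)) :=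
  pairOp_mul_upper _ _ _ (by simp) (by simp) (by simp)

theorem horizDiagOp_mul_crossOp_mul_diagVertOp
    (hYB : ∀ r, triangleUpper (mX r) (mY r) mW = triangleLower (mX r) (mY r) mW) (e : ℤ)
    (i r : ℕ) : horizDiagOp mY e r * crossOp mX i r * diagVertOp mW e i =
      diagVertOp mW e i * crossOp mX i r * horizDiagOp mY e r := by
  unfold horizDiagOp crossOp diagVertOp
  rw [pairOp_mul_lower _ _ _ (by simp) (by simp) (by simp),
    pairOp_mul_upper _ _ _ (by simp) (by simp) (by simp), hYB]

theorem commute_diagVertOp_crossOp (e : ℤ) {i i' : ℕ} (h : i ≠ i') (r : ℕ) :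
    Commute (diagVertOp mW e i) (crossOp mX i' r) :=
  commute_pairOp _ _ (by simp) (by simp) (by simp) (by simpa using h)

theorem commute_horizDiagOp_crossOp (e : ℤ) {r r' : ℕ} (h : r ≠ r') (i : ℕ) :
    Commute (horizDiagOp mY e r) (crossOp mX i r') :=
  commute_pairOp _ _ (by simpa using h) (by simp) (by simp) (by simp)

theorem commute_diagVertOp_tripleOp {e : ℤ} {i i' : ℕ} (h : i ≠ i') {r : ℕ}
    (he : e ≠ (i' : ℤ) - r) : Commute (diagVertOp mW e i) (tripleOp mX mY mW i' r) :=
  Commute.mul_right (Commute.mul_right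
    (commute_pairOp _ _ (by simpa using he) (by simp) (by simp) (by simpa using h))
    (commute_diagVertOp_crossOp _ h _))
    (commute_pairOp _ _ (by simp) (by simpa using he) (by simp) (by simp))

theorem commute_horizDiagOp_tripleOp {e : ℤ} {r r' : ℕ} (h : r ≠ r') {i : ℕ}
    (he : e ≠ (i : ℤ) - r') : Commute (horizDiagOp mY e r) (tripleOp mX mY mW i r') :=
  Commute.mul_right (Commute.mul_right
    (commute_pairOp _ _ (by simp) (by simp) (by simpa using he) (by simp))
    (commute_horizDiagOp_crossOp _ h _))
    (commute_pairOp _ _ (by simpa using h) (by simp) (by simp) (by simpa using he))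

/-- By the Yang-Baxter equation the diagonal lines can be moved to the two frozen corners. -/
theorem gridProd_tripleOp (n : ℕ)
    (hYB : ∀ r, triangleUpper (mX r) (mY r) mW = triangleLower (mX r) (mY r) mW)
    (hY : ∀ r, IsFrozen (mY r)) (hW : IsFrozen mW) :
    gridProd n (tripleOp mX mY mW) (stateIndicator (outState n)) (inState n) =
      gridProd n (crossOp mX) (stateIndicator (outState n)) (inState n) := by
  -- The diagonals with index at least `e` have been removed. All nodes strictly beyond diagonal `e`
  -- are then bare horizontal-vertical crossings, which is what the Yang-Baxter move of that
  -- diagonal needs.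
  have hup : ∀ e : ℕ, e ≤ n →
      gridProd n (fun i r => if r + e ≤ i then crossOp mX i r else tripleOp mX mY mW i r)
          (stateIndicator (outState n)) (inState n) =
        gridProd n (fun i r => if r ≤ i then crossOp mX i r else tripleOp mX mY mW i r)
          (stateIndicator (outState n)) (inState n) := by
    intro e
    induction e with
    | zero => intro _; simp
    | succ e ih =>
      intro he
      have hpush := push_upper (n := n) (e := e) (by omega)
        (fun i r => if r + e ≤ i then crossOp mX i r else tripleOp mX mY mW i r)
        (diagVertOp mW e) (horizDiagOp mY e)
        (fun i r h => by
          simp only [if_pos (show r + e ≤ i by omega)]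
          exact horizDiagOp_mul_crossOp_mul_diagVertOp hYB _ _ _)
        (fun i i' r h => by
          split_ifs with h'
          · exact commute_diagVertOp_crossOp _ h _
          · exact commute_diagVertOp_tripleOp h (by omega))
        (fun i r r' h => by
          split_ifs with h'
          · exact commute_horizDiagOp_crossOp _ h _
          · exact commute_horizDiagOp_tripleOp h (by omega))
      have hB : gridProd n
          (fun i r => if r + (e + 1) ≤ i then crossOp mX i r else tripleOp mX mY mW i r) =
          gridProd n (fun i r => if i = r + e then diagVertOp mW e i *
            (if r + e ≤ i then crossOp mX i r else tripleOp mX mY mW i r) * horizDiagOp mY e r else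
            (if r + e ≤ i then crossOp mX i r else tripleOp mX mY mW i r)) := by
        refine gridProd_congr fun i r _ _ => ?_
        by_cases h : i = r + e
        · rw [if_neg (by omega), if_pos h, if_pos (by omega), tripleOp,
            show (i : ℤ) - r = e by omega]
        · rw [if_neg h]
          by_cases h' : r + e ≤ i
          · rw [if_pos h', if_pos (by omega)]
          · rw [if_neg h', if_neg (by omega)]
      -- Once moved, diagonal `e` crosses the vertical lines where they enter empty and the
      -- horizontal lines where they leave empty; being empty itself, it acts trivially at both
      -- ends.
      rw [hB, hpush, Module.End.mul_apply, Module.End.mul_apply, oprod_apply_apply_eq_of_fixed,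
        oprod_apply_eq_of_fixed, ih (by omega)]
      · intro r _ _
        refine pairOp_stateIndicator (by simp) fun p q => ?_
        have h1 : outState n (.diag (e : ℤ)) = false := by simp [outState]
        rw [h1]
        exact (hY r false p q).2
      · intro i _ _ g
        refine pairOp_apply_of_fixed (fun p q => ?_) g
        have h1 : inState n (.diag (e : ℤ)) = false := by simp [inState]
        rw [h1]
        exact (hW false p q).1
  -- Only the diagonals `-1, …, -(e - 1)` are still present; for `e = 1` there are none.
  have hlow : ∀ e : ℕ, 1 ≤ e → e ≤ n →
      gridProd n (fun i r => if i < r ∧ r < i + e then tripleOp mX mY mW i r else crossOp mX i r)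
          (stateIndicator (outState n)) (inState n) =
        gridProd n (crossOp mX) (stateIndicator (outState n)) (inState n) := by
    intro e he
    induction e, he using Nat.le_induction with
    | base =>
      intro _
      rw [gridProd_congr fun i r _ _ => if_neg (by omega)]
    | succ e he1 ih =>
      intro he
      have hpush := push_lower (n := n) (e := e) (by omega)
        (fun i r => if i < r ∧ r < i + e then tripleOp mX mY mW i r else crossOp mX i r)
        (diagVertOp mW (-e)) (horizDiagOp mY (-e))
        (fun i r h => by
          simp only [if_neg (show ¬ (i < r ∧ r < i + e) by omega)]
          exact (horizDiagOp_mul_crossOp_mul_diagVertOp hYB _ _ _).symm)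
        (fun i i' r h => by
          split_ifs with h'
          · exact commute_diagVertOp_tripleOp h (by omega)
          · exact commute_diagVertOp_crossOp _ h _)
        (fun i r r' h => by
          split_ifs with h'
          · exact commute_horizDiagOp_tripleOp h (by omega)
          · exact commute_horizDiagOp_crossOp _ h _)
      have hB : gridProd n
          (fun i r => if i < r ∧ r < i + (e + 1) then tripleOp mX mY mW i r else crossOp mX i r) =
          gridProd n (fun i r => if r = i + e then horizDiagOp mY (-e) r *
            (if i < r ∧ r < i + e then tripleOp mX mY mW i r else crossOp mX i r) *
              diagVertOp mW (-e) i else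
            (if i < r ∧ r < i + e then tripleOp mX mY mW i r else crossOp mX i r)) := by
        refine gridProd_congr fun i r _ _ => ?_
        by_cases h : r = i + e
        · rw [if_pos (by omega), if_pos h, if_neg (by omega),
            horizDiagOp_mul_crossOp_mul_diagVertOp hYB, tripleOp,
            show (i : ℤ) - r = -e by omega]
        · rw [if_neg h]
          by_cases h' : i < r ∧ r < i + e
          · rw [if_pos h', if_pos (by omega)]
          · rw [if_neg h', if_neg (by omega)]
      -- In the lower left corner the frozen state is the full one: diagonal `-e` is occupied, as
      -- are the horizontal lines where they enter and the vertical lines where they leave.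
      rw [hB, hpush, Module.End.mul_apply, Module.End.mul_apply, oprod_apply_apply_eq_of_fixed,
        oprod_apply_eq_of_fixed, ih (by omega)]
      · intro i _ hi
        refine pairOp_stateIndicator (by simp) fun p q => ?_
        have h1 : outState n (.diag (-(e : ℤ))) = true := by simp [outState]; omega
        have h2 : outState n (.vert i) = true := by simp [outState]; omega
        rw [h1, h2]
        exact (hW true p q).2
      · intro r _ hr g
        refine pairOp_apply_of_fixed (fun p q => ?_) g
        have h1 : inState n (.diag (-(e : ℤ))) = true := by simp [inState]; omega
        have h2 : inState n (.horiz r) = true := by simp [inState]; omega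
        rw [h1, h2]
        exact (hY r true p q).1
  rcases Nat.eq_zero_or_pos n with rfl | hn
  · rfl
  · rw [← hlow n hn le_rfl]
    have h1 := hup n le_rfl
    rw [gridProd_congr (B := tripleOp mX mY mW) fun i r _ _ => if_neg (by omega)] at h1
    rw [h1]
    refine congrArg (fun P : LineOp => P (stateIndicator (outState n)) (inState n))
      (gridProd_congr fun i r _ _ => ?_)
    by_cases h : r ≤ i
    · rw [if_pos h, if_neg (by omega)]
    · rw [if_neg h, if_pos (by omega)]

/-! ## Products of vertex operators as sums over configurations -/

section Expansion

variable {X O : Type*}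

/-- The state reached after `k` steps with the choices `o`. -/
def runSteps (step : ℕ → X → O → X) (x : X) (o : ℕ → O) : ℕ → X
  | 0 => x
  | k + 1 => step k (runSteps step x o k) (o k)

/-- Extension of a finite sequence by a default value. -/
def extendSeq [Inhabited O] {m : ℕ} (o : Fin m → O) (k : ℕ) : O := if h : k < m then o ⟨k, h⟩ else default

theorem extendSeq_val [Inhabited O] {m : ℕ} (o : Fin m → O) (k : Fin m) : extendSeq o k = o k := by
  simp [extendSeq]

theorem runSteps_congr (step : ℕ → X → O → X) (x : X) {o o' : ℕ → O} {m : ℕ}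
    (h : ∀ k, k < m → o k = o' k) : runSteps step x o m = runSteps step x o' m := by
  induction m with
  | zero => rfl
  | succ m ih =>
    rw [runSteps, runSteps, ih fun k hk => h k (by omega), h m (by omega)]

/-- The leftmost operator makes the first step. The induction splits off the last operator, in
accordance with `runSteps`; the default values of `extendSeq` are never read. -/
theorem oprod_apply [Fintype O] [Inhabited O] (T : ℕ → Module.End ℂ (X → ℂ)) (wt : ℕ → X → O → ℂ) (step : ℕ → X → O → X)
    (hT : ∀ k f x, T k f x = ∑ o, wt k x o * f (step k x o)) (m : ℕ) (f : X → ℂ) (x : X) :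
    oprod T 0 m f x = ∑ o : Fin m → O,
      (∏ k : Fin m, wt k (runSteps step x (extendSeq o) k) (o k)) *
        f (runSteps step x (extendSeq o) m) := by
  induction m generalizing f with
  | zero => simp [runSteps]
  | succ m ih =>
    rw [oprod_succ_right, Module.End.mul_apply, ih, Nat.zero_add,
      ← (Fin.snocEquiv fun _ => O).sum_comp, Fintype.sum_prod_type, Finset.sum_comm]
    refine Finset.sum_congr rfl fun o _ => ?_
    rw [hT, Finset.mul_sum]
    refine Finset.sum_congr rfl fun a _ => ?_
    have h0 : (Fin.snocEquiv fun _ => O) (a, o) = (Fin.snoc o a : Fin (m + 1) → O) := rfl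
    have h1 : ∀ k, k < m → extendSeq (Fin.snoc o a : Fin (m + 1) → O) k = extendSeq o k := by
      intro k hk
      rw [extendSeq, extendSeq, dif_pos (by omega), dif_pos hk]
      exact Fin.snoc_castSucc (α := fun _ => O) a o ⟨k, hk⟩
    have h2 : extendSeq (Fin.snoc o a : Fin (m + 1) → O) m = a := by
      rw [extendSeq, dif_pos (by omega)]
      exact Fin.snoc_last (α := fun _ => O) a o
    have h3 : ∀ k, k ≤ m → runSteps step x (extendSeq (Fin.snoc o a : Fin (m + 1) → O)) k =
        runSteps step x (extendSeq o) k :=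
      fun k hk => runSteps_congr step x fun k' hk' => h1 k' (by omega)
    rw [h0, Fin.prod_univ_castSucc, runSteps, h2, h3 m le_rfl]
    simp only [Fin.val_castSucc, Fin.val_last, Fin.snoc_castSucc, Fin.snoc_last, h3 m le_rfl]
    have h4 : ∀ k : Fin m, runSteps step x (extendSeq (Fin.snoc o a : Fin (m + 1) → O)) k =
        runSteps step x (extendSeq o) k := fun k => h3 k k.2.le
    simp only [h4]
    ring

end Expansion

/-! ### Configurations as histories of line states. -/

section Network

variable {n : ℕ}

/-- The `k`-th edge of the `r`-th horizontal line from the top. -/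
def horizEdge (c : Config n) (r k : ℕ) : Bool :=
  if h : r < n ∧ k ≤ n then c.1 ⟨k, by omega⟩ ⟨n - 1 - r, by omega⟩ else false

/-- The `m`-th edge, from the top, of the `i`-th vertical line. -/
def vertEdge (c : Config n) (i m : ℕ) : Bool :=
  if h : i < n ∧ m ≤ n then c.2.1 ⟨i, h.1⟩ ⟨n - m, by omega⟩ else false

/-- The edge of the diagonal `e` which enters column `k`. -/
def diagEdge (c : Config n) (e : ℤ) (k : ℕ) : Bool :=
  if h : k ≤ n ∧ 0 ≤ n + e - k ∧ n + e - k ≤ n then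
    c.2.2 ⟨k, by omega⟩ ⟨(n + e - k).toNat, by omega⟩ else false

theorem horizEdge_eq (c : Config n) {r k : ℕ} (K : Fin (n + 1)) (j : Fin n) (hk : K.val = k)
    (hj : j.val + r + 1 = n) : horizEdge c r k = c.1 K j := by
  rw [horizEdge, dif_pos (by omega)]
  exact congrArg₂ c.1 (Fin.ext (by dsimp only; omega)) (Fin.ext (by dsimp only; omega))

theorem vertEdge_eq (c : Config n) {i m : ℕ} (I : Fin n) (l : Fin (n + 1)) (hi : I.val = i)
    (hl : l.val + m = n) : vertEdge c i m = c.2.1 I l := by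
  rw [vertEdge, dif_pos (by omega)]
  exact congrArg₂ c.2.1 (Fin.ext (by dsimp only; omega)) (Fin.ext (by dsimp only; omega))

theorem diagEdge_eq (c : Config n) {e : ℤ} {k : ℕ} (K l : Fin (n + 1)) (hk : K.val = k)
    (hl : (l.val : ℤ) = n + e - k) : diagEdge c e k = c.2.2 K l := by
  rw [diagEdge, dif_pos (by omega)]
  exact congrArg₂ c.2.2 (Fin.ext (by dsimp only; omega)) (Fin.ext (by dsimp only; omega))

/-- The state of the lines of the configuration `c` after the nodes of the first `r` rows (from the
top) and the first `i` nodes of the following row. -/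
def lineState (c : Config n) (r i : ℕ) : LineState
  | .horiz r' => horizEdge c r' (if r' < r then n else if r' = r then i else 0)
  | .vert i' => vertEdge c i' (if i' < i then r + 1 else r)
  | .diag e => diagEdge c e (min (n : ℤ) (r + e + if r + e < i then 1 else 0)).toNat

/-- The occupation of the edges exiting the nodes, as a triple for the horizontal, the vertical and
the diagonal edges. -/
def outTriple (c : Config n) (r i : Fin n) : Bool × Bool × Bool :=
  (outEdge c i r.rev .east, outEdge c i r.rev .south, outEdge c i r.rev .southeast)

theorem lineState_horiz (c : Config n) (r i : Fin n) :
    lineState c r i (.horiz r) = inEdge c i r.rev .west := by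
  simp only [lineState, lt_irrefl, if_false, if_true]
  exact horizEdge_eq c _ _ rfl (by simp [Fin.val_rev]; omega)

theorem lineState_vert (c : Config n) (r i : Fin n) :
    lineState c r i (.vert i) = inEdge c i r.rev .north := by
  simp only [lineState, lt_irrefl, if_false]
  exact vertEdge_eq c _ _ rfl (by simp [Fin.val_rev]; omega)

/-- Diagonal `e` meets row `r` in column `r + e`, which is `i` here, so neither the truncation to
`[0, n]` nor the shift by one in `lineState` is active. -/
theorem lineState_diag (c : Config n) (r i : Fin n) :
    lineState c r i (.diag ((i : ℤ) - r)) = inEdge c i r.rev .northwest := by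
  simp only [lineState]
  refine diagEdge_eq c _ _ ?_ ?_
  · rw [if_neg (by omega)]
    simp only [Fin.val_castSucc]
    omega
  · rw [if_neg (by omega)]
    simp only [Fin.val_succ, Fin.val_rev]
    omega

theorem lineState_step (c : Config n) (r i : Fin n) :
    Function.update (Function.update (Function.update (lineState c r i) (.horiz r)
      (outTriple c r i).1) (.vert i) (outTriple c r i).2.1) (.diag ((i : ℤ) - r))
      (outTriple c r i).2.2 = lineState c r (i + 1) := by
  funext l
  cases l with
  | horiz r' =>
    rw [Function.update_of_ne (by simp), Function.update_of_ne (by simp)]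
    by_cases h : r' = r
    · subst h
      rw [Function.update_self]
      simp only [lineState, lt_irrefl, if_false, if_true]
      exact (horizEdge_eq c _ _ (by simp) (by simp [Fin.val_rev]; omega)).symm
    · rw [Function.update_of_ne (by simpa using h)]
      simp only [lineState, if_neg h]
  | vert i' =>
    rw [Function.update_of_ne (by simp)]
    by_cases h : i' = i
    · subst h
      rw [Function.update_self]
      simp only [lineState, Nat.lt_succ_self, if_true]
      exact (vertEdge_eq c _ _ (by simp) (by simp)).symm
    · rw [Function.update_of_ne (by simpa using h), Function.update_of_ne (by simp)]
      simp only [lineState]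
      congr 1
      split_ifs <;> omega
  | diag e =>
    by_cases h : e = (i : ℤ) - r
    · subst h
      rw [Function.update_self]
      simp only [lineState]
      refine (diagEdge_eq c _ _ ?_ ?_).symm
      · rw [if_pos (by push_cast; omega)]
        simp only [Fin.val_succ]
        omega
      · rw [if_pos (by push_cast; omega)]
        simp only [Fin.val_castSucc, Fin.val_rev]
        omega
    · rw [Function.update_of_ne (by simpa using h), Function.update_of_ne (by simp),
        Function.update_of_ne (by simp)]
      simp only [lineState]
      congr 3
      push_cast
      split_ifs <;> omega

/-- The truncations by `toNat` and `min` absorb the diagonals that have not yet entered the square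
or have already left it. -/
theorem lineState_succ_zero (c : Config n) {r : ℕ} (hr : r < n) :
    lineState c (r + 1) 0 = lineState c r n := by
  funext l
  cases l with
  | horiz r' =>
    simp only [lineState]
    congr 1
    split_ifs <;> omega
  | vert i' =>
    simp only [lineState, Nat.not_lt_zero, if_false]
    by_cases h : i' < n
    · rw [if_pos h]
    · rw [vertEdge, vertEdge, dif_neg (by omega), dif_neg (by omega)]
  | diag e =>
    simp only [lineState]
    congr 1
    push_cast
    split_ifs <;> omega

/-- The configuration with given boundary edges on the left and on the top and given occupation of
the edges exiting the nodes. -/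
def configOf (x : LineState) (o : Fin n → Fin n → Bool × Bool × Bool) : Config n :=
  (fun k j => Fin.cases (x (.horiz j.rev)) (fun i => (o j.rev i).1) k,
    fun i l => Fin.lastCases (x (.vert i)) (fun j => (o j.rev i).2.1) l,
    fun k l => Fin.cases (x (.diag ((l : ℤ) - n)))
      (fun i => Fin.lastCases (x (.diag ((i : ℤ) + 1))) (fun j => (o j.rev i).2.2) l) k)

theorem outTriple_configOf (x : LineState) (o : Fin n → Fin n → Bool × Bool × Bool) :
    outTriple (configOf x o) = o := by
  funext r i
  simp [outTriple, configOf, outEdge]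

theorem lineState_zero_horiz (c : Config n) (j : Fin n) :
    lineState c 0 0 (.horiz j.rev) = c.1 0 j := by
  simp only [lineState, Nat.not_lt_zero, if_false, ite_self]
  exact horizEdge_eq c _ _ (by simp) (by simp only [Fin.val_rev]; omega)

theorem lineState_zero_vert (c : Config n) (i : Fin n) :
    lineState c 0 0 (.vert i) = c.2.1 i (Fin.last n) := by
  simp only [lineState, Nat.not_lt_zero, if_false]
  exact vertEdge_eq c _ _ rfl (by simp)

theorem lineState_zero_diag_left (c : Config n) (l : Fin (n + 1)) :
    lineState c 0 0 (.diag ((l : ℤ) - n)) = c.2.2 0 l := by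
  simp only [lineState]
  refine diagEdge_eq c _ _ ?_ ?_
  · push_cast
    split_ifs <;> simp <;> omega
  · push_cast
    split_ifs <;> omega

theorem lineState_zero_diag_top (c : Config n) (k : Fin (n + 1)) :
    lineState c 0 0 (.diag k) = c.2.2 k (Fin.last n) := by
  simp only [lineState]
  refine diagEdge_eq c _ _ ?_ ?_
  · push_cast
    rw [if_neg (by omega)]
    omega
  · push_cast
    rw [if_neg (by omega)]
    simp
    omega

/-- Every slot either lies on the entering boundary (left or top) or is the exit of exactly one
node, so the entering state and the exits of the nodes determine the configuration. -/
theorem configOf_lineState (c : Config n) : configOf (lineState c 0 0) (outTriple c) = c := by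
  refine Prod.ext ?_ (Prod.ext ?_ ?_)
  · funext k j
    refine Fin.cases ?_ (fun i => ?_) k
    · exact lineState_zero_horiz c j
    · simp [configOf, outTriple, outEdge]
  · funext i l
    refine Fin.lastCases ?_ (fun j => ?_) l
    · simpa [configOf] using lineState_zero_vert c i
    · simp [configOf, outTriple, outEdge]
  · funext k l
    refine Fin.cases ?_ (fun i => ?_) k
    · exact lineState_zero_diag_left c l
    · refine Fin.lastCases ?_ (fun j => ?_) l
      · simpa [configOf] using lineState_zero_diag_top c i.succ
      · simp [configOf, outTriple, outEdge]

/-- The line states which vanish away from the square. -/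
structure IsBoundaryState (n : ℕ) (x : LineState) : Prop where
  horiz : ∀ r, n ≤ r → x (.horiz r) = false
  vert : ∀ i, n ≤ i → x (.vert i) = false
  diag : ∀ e : ℤ, (e < -n ∨ n < e) → x (.diag e) = false

theorem lineState_configOf {x : LineState} (hx : IsBoundaryState n x)
    (o : Fin n → Fin n → Bool × Bool × Bool) : lineState (configOf x o) 0 0 = x := by
  funext l
  cases l with
  | horiz r =>
    by_cases h : r < n
    · have := lineState_zero_horiz (configOf x o) (Fin.rev ⟨r, h⟩)
      rw [Fin.rev_rev] at this
      rw [this]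
      simp only [configOf, Fin.cases_zero, Fin.rev_rev]
    · rw [hx.horiz r (by omega), lineState, horizEdge, dif_neg (by omega)]
  | vert i =>
    by_cases h : i < n
    · rw [lineState_zero_vert (configOf x o) ⟨i, h⟩]
      simp [configOf]
    · rw [hx.vert i (by omega), lineState, vertEdge, dif_neg (by omega)]
  | diag e =>
    by_cases h : e < -n ∨ n < e
    · rw [hx.diag e h, lineState, diagEdge, dif_neg]
      push_cast
      split_ifs <;> omega
    -- Diagonals `e ≤ 0` enter through the left side, the others through the top; the corner
    -- diagonal `e = 0` is counted on the left, as in `configOf`.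
    · by_cases h0 : e ≤ 0
      · have h1 := lineState_zero_diag_left (configOf x o) ⟨(n + e).toNat, by omega⟩
        have h2 : (((⟨(n + e).toNat, by omega⟩ : Fin (n + 1)) : ℕ) : ℤ) - n = e := by
          simp only
          omega
        rw [h2] at h1
        rw [h1]
        simp only [configOf, Fin.cases_zero, h2]
      · have h2 : e = ((⟨(e - 1).toNat, by omega⟩ : Fin n) : ℕ) + 1 := by
          simp only
          omega
        have h1 := lineState_zero_diag_top (configOf x o) (Fin.succ ⟨(e - 1).toNat, by omega⟩)
        rw [Fin.val_succ, Nat.cast_add, Nat.cast_one, ← h2] at h1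
        rw [h1]
        simp only [configOf, Fin.cases_succ, Fin.lastCases_last, ← h2]

-- Expanding the operators gives a sum over all choices of exits; `outTriple` and `configOf`
-- identify these choices with the configurations entering in state `x`.
open Classical in
theorem gridProd_nodeOp_eq_sum (M : ℕ → ℕ → Bool → Bool → Bool → Bool → Bool → Bool → ℂ)
    {x : LineState} (hx : IsBoundaryState n x) (f : LineState → ℂ) :
    gridProd n (fun i r => nodeOp (M i r) (.horiz r) (.vert i) (.diag ((i : ℤ) - r))) f x =
      ∑ c : Config n, if lineState c 0 0 = x then
        (∏ r : Fin n, ∏ i : Fin n, M i r (inEdge c i r.rev .west) (inEdge c i r.rev .north)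
          (inEdge c i r.rev .northwest) (outEdge c i r.rev .east) (outEdge c i r.rev .south)
          (outEdge c i r.rev .southeast)) * f (lineState c n 0) else 0 := by
  set step : ℕ → ℕ → LineState → Bool × Bool × Bool → LineState := fun r i x o =>
    Function.update (Function.update (Function.update x (.horiz r) o.1) (.vert i) o.2.1)
      (.diag ((i : ℤ) - r)) o.2.2 with hstep
  set wt : ℕ → ℕ → LineState → Bool × Bool × Bool → ℂ := fun r i x o =>
    M i r (x (.horiz r)) (x (.vert i)) (x (.diag ((i : ℤ) - r))) o.1 o.2.1 o.2.2 with hwt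
  set rowStep : ℕ → LineState → (Fin n → Bool × Bool × Bool) → LineState := fun r x o =>
    runSteps (step r) x (extendSeq o) n with hrowStep
  rw [gridProd, oprod_apply _ (fun r x (o : Fin n → Bool × Bool × Bool) =>
    ∏ i : Fin n, wt r i (runSteps (step r) x (extendSeq o) i) (o i)) rowStep
    (fun r f x => oprod_apply _ (wt r) (step r) (fun i f x => rfl) n f x)]
  rw [← Finset.sum_filter]
  have hin : ∀ (c : Config n) (r : Fin n) (i : ℕ), i ≤ n →
      runSteps (step r) (lineState c r 0) (extendSeq (outTriple c r)) i = lineState c r i := by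
    intro c r i
    induction i with
    | zero => intro _; rfl
    | succ i ih =>
      intro hi
      rw [runSteps, ih (by omega)]
      have h1 := extendSeq_val (outTriple c r) ⟨i, hi⟩
      have h2 := lineState_step c r ⟨i, hi⟩
      simp only at h1 h2
      rw [h1, ← h2]
  have hout : ∀ (c : Config n) (r : ℕ), r ≤ n →
      runSteps rowStep (lineState c 0 0) (extendSeq (outTriple c)) r = lineState c r 0 := by
    intro c r
    induction r with
    | zero => intro _; rfl
    | succ r ih =>
      intro hr
      rw [runSteps, ih (by omega), lineState_succ_zero c hr]
      have h1 := extendSeq_val (outTriple c) ⟨r, hr⟩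
      simp only at h1
      rw [h1]
      exact hin c ⟨r, hr⟩ n le_rfl
  symm
  refine Finset.sum_bij' (fun c _ => outTriple c) (fun o _ => configOf x o) ?_ ?_ ?_ ?_ ?_
  · intro c _
    exact Finset.mem_univ _
  · intro o _
    exact Finset.mem_filter.2 ⟨Finset.mem_univ _, lineState_configOf hx o⟩
  · intro c hc
    rw [← (Finset.mem_filter.1 hc).2]
    exact configOf_lineState c
  · intro o _
    exact outTriple_configOf x o
  · intro c hc
    obtain rfl := (Finset.mem_filter.1 hc).2
    rw [hout c n le_rfl]
    congr 1
    refine Finset.prod_congr rfl fun r _ => Finset.prod_congr rfl fun i _ => ?_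
    rw [hout c r r.2.le, hin c r i i.2.le, hwt]
    simp only [lineState_horiz, lineState_vert, lineState_diag, outTriple]

end Network

/-! ### Domain wall boundary conditions as a pair of line states. -/

section Boundary

variable {n : ℕ}

theorem isBoundaryState_lineState (c : Config n) (r : ℕ) : IsBoundaryState n (lineState c r 0) where
  horiz r' h := by rw [lineState, horizEdge, dif_neg (by omega)]
  vert i h := by rw [lineState, vertEdge, dif_neg (by omega)]
  diag e h := by
    rw [lineState, diagEdge, dif_neg]
    push_cast
    split_ifs <;> omega

theorem isBoundaryState_inState (n : ℕ) : IsBoundaryState n (inState n) where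
  horiz r h := by simp [inState, h]
  vert i h := rfl
  diag e h := by simp [inState]; omega

theorem isBoundaryState_outState (n : ℕ) : IsBoundaryState n (outState n) where
  horiz r h := rfl
  vert i h := by simp [outState, h]
  diag e h := by simp [outState]; omega

theorem IsBoundaryState.eq_of_agree {x y : LineState} (hx : IsBoundaryState n x)
    (hy : IsBoundaryState n y) (hh : ∀ j : Fin n, x (.horiz j.rev) = y (.horiz j.rev))
    (hv : ∀ i : Fin n, x (.vert i) = y (.vert i))
    (hl : ∀ l : Fin (n + 1), x (.diag ((l : ℤ) - n)) = y (.diag ((l : ℤ) - n)))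
    (ht : ∀ k : Fin (n + 1), x (.diag k) = y (.diag k)) : x = y := by
  funext l
  cases l with
  | horiz r =>
    by_cases h : r < n
    · simpa only [Fin.rev_rev] using hh (Fin.rev ⟨r, h⟩)
    · rw [hx.horiz r (by omega), hy.horiz r (by omega)]
  | vert i =>
    by_cases h : i < n
    · exact hv ⟨i, h⟩
    · rw [hx.vert i (by omega), hy.vert i (by omega)]
  | diag e =>
    by_cases h : e < -n ∨ n < e
    · rw [hx.diag e h, hy.diag e h]
    · by_cases h0 : e ≤ 0
      · have := hl ⟨(n + e).toNat, by omega⟩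
        have h2 : (((⟨(n + e).toNat, by omega⟩ : Fin (n + 1)) : ℕ) : ℤ) - n = e := by
          dsimp only
          omega
        rwa [h2] at this
      · have := ht ⟨e.toNat, by omega⟩
        have h2 : (((⟨e.toNat, by omega⟩ : Fin (n + 1)) : ℕ) : ℤ) = e := by
          dsimp only
          omega
        rwa [h2] at this

theorem lineState_last_horiz (c : Config n) (j : Fin n) :
    lineState c n 0 (.horiz j.rev) = c.1 (Fin.last n) j := by
  simp only [lineState, Fin.is_lt, if_true]
  exact horizEdge_eq c _ _ (by simp) (by simp only [Fin.val_rev]; omega)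

theorem lineState_last_vert (c : Config n) (i : Fin n) :
    lineState c n 0 (.vert i) = c.2.1 i 0 := by
  simp only [lineState, Nat.not_lt_zero, if_false]
  exact vertEdge_eq c _ _ rfl (by simp)

theorem lineState_last_diag_bottom (c : Config n) (k : Fin (n + 1)) :
    lineState c n 0 (.diag ((k : ℤ) - n)) = c.2.2 k 0 := by
  simp only [lineState]
  refine diagEdge_eq c _ _ ?_ ?_
  · push_cast
    split_ifs <;> omega
  · have h0 : ((0 : Fin (n + 1)) : ℕ) = 0 := rfl
    push_cast
    split_ifs <;> omega

theorem lineState_last_diag_right (c : Config n) (l : Fin (n + 1)) :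
    lineState c n 0 (.diag l) = c.2.2 (Fin.last n) l := by
  simp only [lineState]
  refine diagEdge_eq c _ _ ?_ ?_
  · push_cast
    rw [if_neg (by omega)]
    omega
  · push_cast
    rw [if_neg (by omega)]
    omega

/-- The two exceptional empty corner edges are the ends of diagonal 0. The slots `d 0 0` and `d n
n`, which are not edges, are recorded as the diagonals `-n` and `n`, empty in both states. -/
theorem lineState_eq_iff_dwbc2 (c : Config n) :
    (lineState c 0 0 = inState n ∧ lineState c n 0 = outState n) ↔ DWBC2 c := by
  constructor
  · rintro ⟨h0, h1⟩
    refine ⟨?_, ?_, ?_, ?_, ?_, ?_, ?_, ?_, ?_⟩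
    · intro j
      rw [← lineState_zero_horiz, h0]
      simp [inState, j.pos]
    · intro j
      rw [← lineState_last_horiz, h1]
      rfl
    · intro i
      rw [← lineState_last_vert, h1]
      simp [outState]
    · intro i
      rw [← lineState_zero_vert, h0]
      rfl
    · intro l hl hl'
      rw [← lineState_zero_diag_left, h0]
      have h2 : l.val ≠ 0 := fun h => hl (Fin.ext h)
      have h3 : l.val ≠ n := fun h => hl' (Fin.ext h)
      simp only [inState, decide_eq_true_eq]
      omega
    · intro k hk hk'
      rw [← lineState_last_diag_bottom, h1]
      have h2 : k.val ≠ 0 := fun h => hk (Fin.ext h)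
      have h3 : k.val ≠ n := fun h => hk' (Fin.ext h)
      simp only [outState, decide_eq_true_eq]
      omega
    · intro k
      rw [← lineState_zero_diag_top, h0]
      simp [inState]
    · intro l
      rw [← lineState_last_diag_right, h1]
      simp [outState]
    · rw [← lineState_zero_diag_left, h0]
      simp [inState]
  · intro h
    have hl : ∀ l : Fin (n + 1), c.2.2 0 l = decide (-(n : ℤ) < (l : ℤ) - n ∧ (l : ℤ) - n < 0) := by
      intro l
      by_cases h0 : l = 0
      · subst h0
        simp [h.noEdge]
      · by_cases h1 : l = Fin.last n
        · subst h1
          simp [h.diagTop]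
        · rw [h.diagLeft l h0 h1]
          have h2 : l.val ≠ 0 := fun h => h0 (Fin.ext h)
          have h3 : l.val ≠ n := fun h => h1 (Fin.ext h)
          symm
          rw [decide_eq_true_eq]
          omega
    have hb : ∀ k : Fin (n + 1), c.2.2 k 0 = decide (-(n : ℤ) < (k : ℤ) - n ∧ (k : ℤ) - n < 0) := by
      intro k
      by_cases h0 : k = 0
      · subst h0
        simp [h.noEdge]
      · by_cases h1 : k = Fin.last n
        · subst h1
          simp [h.diagRight]
        · rw [h.diagBottom k h0 h1]
          have h2 : k.val ≠ 0 := fun h => h0 (Fin.ext h)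
          have h3 : k.val ≠ n := fun h => h1 (Fin.ext h)
          symm
          rw [decide_eq_true_eq]
          omega
    constructor
    · refine (isBoundaryState_lineState c 0).eq_of_agree (isBoundaryState_inState n) ?_ ?_ ?_ ?_
      · intro j
        rw [lineState_zero_horiz, h.left]
        simp [inState, j.pos]
      · intro i
        rw [lineState_zero_vert, h.top]
        rfl
      · intro l
        rw [lineState_zero_diag_left, hl]
        rfl
      · intro k
        rw [lineState_zero_diag_top, h.diagTop]
        simp [inState]
    · refine (isBoundaryState_lineState c n).eq_of_agree (isBoundaryState_outState n) ?_ ?_ ?_ ?_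
      · intro j
        rw [lineState_last_horiz, h.right]
        rfl
      · intro i
        rw [lineState_last_vert, h.bottom]
        simp [outState]
      · intro l
        rw [lineState_last_diag_bottom, hb]
        rfl
      · intro k
        rw [lineState_last_diag_right, h.diagRight]
        simp [outState]

open Classical in
/-- The matrix element of a product of triple crossings between the domain wall states is a
partition function with domain wall boundary conditions. -/
theorem gridProd_nodeOp_dwbc2 (n : ℕ)
    (M : ℕ → ℕ → Bool → Bool → Bool → Bool → Bool → Bool → ℂ) :
    gridProd n (fun i r => nodeOp (M i r) (.horiz r) (.vert i) (.diag ((i : ℤ) - r)))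
      (stateIndicator (outState n)) (inState n) =
      ∑ c : Config n, if DWBC2 c then
        ∏ i : Fin n, ∏ j : Fin n, M i j.rev (inEdge c i j .west) (inEdge c i j .north)
          (inEdge c i j .northwest) (outEdge c i j .east) (outEdge c i j .south)
          (outEdge c i j .southeast) else 0 := by
  rw [gridProd_nodeOp_eq_sum M (isBoundaryState_inState n)]
  refine Finset.sum_congr rfl fun c _ => ?_
  simp only [← lineState_eq_iff_dwbc2, stateIndicator]
  by_cases h0 : lineState c 0 0 = inState n
  · by_cases h1 : lineState c n 0 = outState n
    · rw [if_pos h0, if_pos h1, if_pos ⟨h0, h1⟩, mul_one, Finset.prod_comm]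
      refine Finset.prod_congr rfl fun i _ => ?_
      exact Fintype.prod_equiv Fin.revPerm _ _ fun j => by simp
    · rw [if_pos h0, if_neg h1, mul_zero, if_neg fun h => h1 h.2]
  · rw [if_neg h0, if_neg fun h => h0 h.1]

end Boundary

/-! ## From the 20V model to the 6V model -/

section Reduction

variable {n : ℕ}

/-- The domain wall boundary condition on the square grid. -/
structure DWBC6V (e : Config6V n) : Prop where
  left : ∀ j, e.1 0 j = true
  right : ∀ j, e.1 (Fin.last n) j = false
  bottom : ∀ i, e.2 i 0 = true
  top : ∀ i, e.2 i (Fin.last n) = false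

/-- The occupation of the diagonal edges when no diagonal path bends. -/
def straightDiag (n : ℕ) (k l : Fin (n + 1)) : Bool :=
  decide (0 < k.val + l.val ∧ k.val + l.val < n)

theorem dwbc2_straightDiag {e : Config6V n} :
    DWBC2 ((e.1, e.2, straightDiag n) : Config n) ↔ DWBC6V e := by
  constructor
  · intro h
    exact ⟨h.left, h.right, h.bottom, h.top⟩
  · intro h
    refine ⟨h.left, h.right, h.bottom, h.top, ?_, ?_, ?_, ?_, ?_⟩
    · intro l hl hl'
      have h2 : l.val ≠ 0 := fun h => hl (Fin.ext h)
      have h3 : l.val ≠ n := fun h => hl' (Fin.ext h)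
      have h0 : ((0 : Fin (n + 1)) : ℕ) = 0 := rfl
      refine decide_eq_true ?_
      omega
    · intro k hk hk'
      have h2 : k.val ≠ 0 := fun h => hk (Fin.ext h)
      have h3 : k.val ≠ n := fun h => hk' (Fin.ext h)
      have h0 : ((0 : Fin (n + 1)) : ℕ) = 0 := rfl
      refine decide_eq_true ?_
      omega
    · intro k
      simp [straightDiag]
    · intro l
      simp [straightDiag]
    · simp [straightDiag]

/-- The sum of the two indices is constant along a diagonal line, so the left and top boundary
values propagate column by column. -/
theorem eq_straightDiag {c : Config n} (h : DWBC2 c)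
    (hd : ∀ i j, outEdge c i j .southeast = inEdge c i j .northwest) :
    c.2.2 = straightDiag n := by
  funext k
  refine Fin.induction ?_ (fun i ih => ?_) k
  · funext l
    by_cases h0 : l = 0
    · subst h0
      simp [h.noEdge, straightDiag]
    · by_cases h1 : l = Fin.last n
      · subst h1
        simp [h.diagTop, straightDiag]
      · rw [h.diagLeft l h0 h1]
        have h2 : l.val ≠ 0 := fun h => h0 (Fin.ext h)
        have h3 : l.val ≠ n := fun h => h1 (Fin.ext h)
        symm
        have h0 : ((0 : Fin (n + 1)) : ℕ) = 0 := rfl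
        refine decide_eq_true ?_
        omega
  · funext l
    refine Fin.lastCases ?_ (fun j => ?_) l
    · simp [h.diagTop, straightDiag]
    · have := hd i j
      simp only [outEdge, inEdge] at this
      rw [this, ih]
      simp only [straightDiag, Fin.val_castSucc, Fin.val_succ]
      rw [decide_eq_decide]
      omega

-- If no diagonal path bends, the boundary determines all diagonal edges, and the sum over them has
-- a single nonzero term.
open Classical in
theorem sum_dwbc2_straight (n : ℕ) (F : Fin n → Fin n → Bool → Bool → Bool → Bool → ℂ) :
    (∑ c : Config n, if DWBC2 c then ∏ i : Fin n, ∏ j : Fin n,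
        (if outEdge c i j .southeast = inEdge c i j .northwest then
          F i j (inEdge c i j .west) (inEdge c i j .north) (outEdge c i j .east)
            (outEdge c i j .south) else 0) else 0) =
      ∑ e : Config6V n, if DWBC6V e then ∏ i : Fin n, ∏ j : Fin n,
        F i j (inEdge6V e i j .west) (inEdge6V e i j .north) (outEdge6V e i j .east)
          (outEdge6V e i j .south) else 0 := by
  rw [Fintype.sum_prod_type, Fintype.sum_prod_type]
  refine Finset.sum_congr rfl fun h _ => ?_
  rw [Fintype.sum_prod_type]
  refine Finset.sum_congr rfl fun v _ => ?_
  rw [Fintype.sum_eq_single (straightDiag n)]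
  · have hiff := dwbc2_straightDiag (e := ((h, v) : Config6V n))
    by_cases hb : DWBC6V ((h, v) : Config6V n)
    · rw [if_pos hb, if_pos (hiff.2 hb)]
      refine Finset.prod_congr rfl fun i _ => Finset.prod_congr rfl fun j _ => ?_
      rw [if_pos]
      · rfl
      · simp only [outEdge, inEdge, straightDiag, Fin.val_castSucc, Fin.val_succ]
        rw [decide_eq_decide]
        omega
    · rw [if_neg hb, if_neg fun h' => hb (hiff.1 h')]
  · intro d hd
    by_cases hb : DWBC2 ((h, v, d) : Config n)
    · rw [if_pos hb]
      by_contra hne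
      refine hd (eq_straightDiag hb fun i j => ?_)
      by_contra hij
      refine hne (Finset.prod_eq_zero (Finset.mem_univ i) (Finset.prod_eq_zero
        (Finset.mem_univ j) ?_))
      rw [if_neg hij]
    · rw [if_neg hb]

open Classical in
/-- The partition function of a model whose triple crossings are made of three six-vertex
crossings is that of the six-vertex model. -/
theorem sum_triangle_eq_sum_six {mX mY : ℕ → Bool → Bool → Bool → Bool → ℂ}
    {mW : Bool → Bool → Bool → Bool → ℂ}
    (hYB : ∀ r, triangleUpper (mX r) (mY r) mW = triangleLower (mX r) (mY r) mW)
    (hY : ∀ r, IsFrozen (mY r)) (hW : IsFrozen mW) :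
    (∑ c : Config n, if DWBC2 c then ∏ i : Fin n, ∏ j : Fin n,
        triangleUpper (mX j.rev) (mY j.rev) mW (inEdge c i j .west) (inEdge c i j .north)
          (inEdge c i j .northwest) (outEdge c i j .east) (outEdge c i j .south)
          (outEdge c i j .southeast) else 0) =
      ∑ e : Config6V n, if DWBC6V e then ∏ i : Fin n, ∏ j : Fin n,
        mX j.rev (inEdge6V e i j .west) (inEdge6V e i j .north) (outEdge6V e i j .east)
          (outEdge6V e i j .south) else 0 := by
  have h1 := gridProd_nodeOp_dwbc2 n fun _ r => triangleUpper (mX r) (mY r) mW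
  have h2 := gridProd_nodeOp_dwbc2 n fun _ r h v d p q u => if u = d then mX r h v p q else 0
  rw [← sum_dwbc2_straight n fun _ j => mX j.rev]
  rw [gridProd_congr (B := tripleOp mX mY mW) fun i r _ _ => (tripleOp_eq_nodeOp i r).symm] at h1
  rw [gridProd_congr (B := crossOp mX) fun i r _ _ =>
    (pairOp_eq_nodeOp (mX r) (by simp) (by simp)).symm] at h2
  rw [← h1, ← h2, gridProd_tripleOp n hYB hY hW]

end Reduction

/-! ### Reflection exchanging the top row and the last column. -/

section Transpose

variable {n : ℕ}

/-- Reflection of the square grid in its diagonal. -/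
def transpose6V (n : ℕ) : Config6V n ≃ Config6V n where
  toFun e := (fun k j => e.2 j k, fun i l => e.1 l i)
  invFun e := (fun k j => e.2 j k, fun i l => e.1 l i)
  left_inv _ := rfl
  right_inv _ := rfl

theorem isConfig6V_transpose {e : Config6V n} (h : IsConfig6V e) :
    IsConfig6V (transpose6V n e) where
  left j := h.bottom j
  right j := h.top j
  bottom i := h.left i
  top i := h.right i
  ice i j := by
    have := h.ice j i
    simp only [transpose6V, Equiv.coe_fn_mk, inEdge6V, outEdge6V] at this ⊢
    omega

theorem isConfig6V_transpose_iff {e : Config6V n} :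
    IsConfig6V (transpose6V n e) ↔ IsConfig6V e :=
  ⟨fun h => isConfig6V_transpose h, isConfig6V_transpose⟩

/-- The reflection exchanges West with South and North with East, hence entering with exiting edges;
the weights are invariant under this reversal of the paths. -/
theorem prod_weight6V_transpose (a b c : ℂ) (e : Config6V n) :
    (∏ i : Fin n, ∏ j : Fin n, weight6V a b c (inEdge6V (transpose6V n e) i j .north)
      (inEdge6V (transpose6V n e) i j .west) (outEdge6V (transpose6V n e) i j .east)
      (outEdge6V (transpose6V n e) i j .south)) =
    ∏ i : Fin n, ∏ j : Fin n, weight6V a b c (inEdge6V e i j .north) (inEdge6V e i j .west)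
      (outEdge6V e i j .east) (outEdge6V e i j .south) := by
  rw [Finset.prod_comm]
  refine Finset.prod_congr rfl fun i _ => Finset.prod_congr rfl fun j _ => ?_
  have hsymm : ∀ N W E S : Bool, weight6V a b c E S N W = weight6V a b c N W E S := by
    intro N W E S
    cases N <;> cases W <;> cases E <;> cases S <;> rfl
  rw [← hsymm]
  rfl

end Transpose

/-! ## The uppermost path -/

section Paths

variable {n : ℕ}

theorem exists_eq_decide_le {h : Fin (n + 1) → Bool} (h0 : h 0 = true)
    (hlast : h (Fin.last n) = false)
    (hmono : ∀ i : Fin n, h i.succ = true → h i.castSucc = true) :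
    ∃ L : Fin n, ∀ k : Fin (n + 1), h k = decide (k.val ≤ L.val) := by
  induction n with
  | zero =>
    have : (0 : Fin 1) = Fin.last 0 := rfl
    rw [this, hlast] at h0
    exact absurd h0 (by simp)
  | succ n ih =>
    by_cases h1 : h 1 = true
    · obtain ⟨L, hL⟩ := ih (h := fun k => h k.succ) h1 hlast fun i hi => hmono i.succ hi
      refine ⟨L.succ, fun k => ?_⟩
      refine Fin.cases ?_ (fun k => ?_) k
      · simp [h0]
      · rw [hL k]
        simp
    · have hf : ∀ k : Fin (n + 1), h k.succ = false := by
        intro k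
        refine Fin.induction ?_ (fun i hi => ?_) k
        · simpa using h1
        · by_contra hne
          have := hmono i.succ (by simpa using hne)
          rw [← Fin.succ_castSucc, hi] at this
          exact absurd this (by simp)
      refine ⟨0, fun k => ?_⟩
      refine Fin.cases ?_ (fun k => ?_) k
      · simp [h0]
      · rw [hf k]
        simp

/-- The type of the step by which the uppermost path leaves the top line: `true` for a diagonal step,
`false` for a vertical one. -/
def leavingStep : Bool → Out
  | true => .southeast
  | false => .south

/-- The top row of a configuration whose uppermost path leaves the top line in column `L`. -/
theorem exists_topRow {c : Config n} (hc : IsConfig20V c) {j : Fin n} (hj : j.val + 1 = n) :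
    ∃ (L : Fin n) (b : Bool), (∀ i, inEdge c i j .west = decide (i.val ≤ L.val)) ∧
      (∀ i, inEdge c i j .north = false) ∧ (∀ i, inEdge c i j .northwest = false) ∧
      (∀ i, outEdge c i j .east = decide (i.val < L.val)) ∧
      (∀ i, outEdge c i j .southeast = (decide (i.val = L.val) && b)) ∧
      (∀ i, outEdge c i j .south = (decide (i.val = L.val) && !b)) := by
  have hjl : j.succ = Fin.last n := Fin.ext (by simpa using hj)
  have hN : ∀ i, inEdge c i j .north = false := fun i => by
    simp only [inEdge, hjl]
    exact hc.1.top i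
  have hNW : ∀ i, inEdge c i j .northwest = false := fun i => by
    simp only [inEdge, hjl]
    exact hc.1.diagTop _
  have hice : ∀ i, (inEdge c i j .west).toNat = (outEdge c i j .east).toNat +
      (outEdge c i j .southeast).toNat + (outEdge c i j .south).toNat := fun i => by
    have := hc.2 i j
    rw [IceRule, hN, hNW] at this
    simpa using this
  obtain ⟨L, hL⟩ := exists_eq_decide_le (h := fun k => c.1 k j) (hc.1.left j) (hc.1.right j)
    (fun i hi => by
      have := hice i
      simp only [inEdge, outEdge, hi, Bool.toNat_true] at this
      by_contra hne
      rw [Bool.not_eq_true] at hne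
      rw [hne, Bool.toNat_false] at this
      omega)
  have hW : ∀ i, inEdge c i j .west = decide (i.val ≤ L.val) := fun i => by
    simpa [inEdge] using hL i.castSucc
  have hE : ∀ i, outEdge c i j .east = decide (i.val < L.val) := fun i => by
    simpa [outEdge, Nat.succ_le_iff] using hL i.succ
  have haux : ∀ w e s t : Bool, w.toNat = e.toNat + s.toNat + t.toNat → w = e →
      s = false ∧ t = false := by decide
  have haux' : ∀ s t : Bool, true.toNat = false.toNat + s.toNat + t.toNat → t = !s := by decide
  refine ⟨L, outEdge c L j .southeast, hW, hN, hNW, hE, fun i => ?_, fun i => ?_⟩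
  · by_cases hi : i = L
    · subst hi
      simp
    · have hi' : i.val ≠ L.val := fun h => hi (Fin.ext h)
      rw [(haux _ _ _ _ (hice i) (by rw [hW, hE, decide_eq_decide]; omega)).1]
      simp [hi']
  · by_cases hi : i = L
    · subst hi
      have := hice i
      rw [hW, hE] at this
      rw [haux' (outEdge c i j .southeast) (outEdge c i j .south) (by simpa using this)]
      simp
    · have hi' : i.val ≠ L.val := fun h => hi (Fin.ext h)
      rw [(haux _ _ _ _ (hice i) (by rw [hW, hE, decide_eq_decide]; omega)).2]
      simp [hi']

/-- With nothing entering from above, the top row carries only the uppermost path, whose exit can be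
read off from the occupied edges. -/
theorem leavesTop_iff {c : Config n} {j : Fin n} (hj : j.val + 1 = n) {L : Fin n} {b : Bool}
    (hW : ∀ i, inEdge c i j .west = decide (i.val ≤ L.val))
    (hN : ∀ i, inEdge c i j .north = false) (hNW : ∀ i, inEdge c i j .northwest = false)
    (hE : ∀ i, outEdge c i j .east = decide (i.val < L.val))
    (hSE : ∀ i, outEdge c i j .southeast = (decide (i.val = L.val) && b))
    (hS : ∀ i, outEdge c i j .south = (decide (i.val = L.val) && !b)) (L' : Fin n) (b' : Bool) :
    LeavesTop c L' (leavingStep b') ↔ L' = L ∧ b' = b := by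
  constructor
  · rintro ⟨-, j', a, hj', -, -, hout, -⟩
    obtain rfl : j' = j := Fin.ext (by omega)
    cases b' with
    | true =>
      simp only [leavingStep, hSE, Bool.and_eq_true, decide_eq_true_eq] at hout
      exact ⟨Fin.ext hout.1, hout.2.symm⟩
    | false =>
      simp only [leavingStep, hS, Bool.and_eq_true, decide_eq_true_eq] at hout
      exact ⟨Fin.ext hout.1, by simpa using hout.2.symm⟩
  · rintro ⟨rfl, rfl⟩
    have hon : ∀ m (hm : m < n), m ≤ L'.val → OnUppermost c ⟨m, hm⟩ j .west := by
      intro m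
      induction m with
      | zero => exact fun _ _ => .start _ _ rfl hj
      | succ m ih =>
        intro hm hmL
        refine .east ⟨m, by omega⟩ j _ .west (ih _ (by omega)) ⟨?_, ?_, ?_⟩ rfl
        · rw [hW]
          simp only [decide_eq_true_eq]
          omega
        · rw [hE]
          simpa using hmL
        · simp [inAbove, outAbove, hN, hNW]
    refine ⟨by cases b' <;> simp [leavingStep], j, .west, hj, hon _ L'.2 le_rfl, ?_, ?_, ?_⟩
    · simp [hW]
    · cases b' <;> simp [leavingStep, hSE, hS]
    · cases b' <;> simp [leavingStep, inAbove, outAbove, hN, hNW, hE, hSE]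

theorem OnUppermost6V.inEdge_eq_true {e : Config6V n} (he : IsConfig6V e) {i j : Fin n} {a : Inc6V}
    (h : OnUppermost6V e i j a) : inEdge6V e i j a = true := by
  cases h with
  | start _ _ hi hj =>
    have : i.castSucc = 0 := Fin.ext (by simpa using hi)
    simp only [inEdge6V, this]
    exact he.left j
  | east i₀ _ _ a _ hcont hi =>
    have : i.castSucc = i₀.succ := Fin.ext (by simpa using hi)
    simp only [inEdge6V, this]
    exact hcont.2.1
  | south _ j₀ _ a _ hcont hj =>
    have : j.succ = j₀.castSucc := Fin.ext (by simpa using hj)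
    simp only [inEdge6V, this]
    exact hcont.2.1

/-- The uppermost path goes down from every row it visits, and no path is above it. -/
theorem exists_south_of_onUppermost6V {e : Config6V n} (he : IsConfig6V e) (j : Fin n) (m : ℕ) :
    ∀ (p : Fin n) (a : Inc6V), n ≤ p.val + m → OnUppermost6V e p j a → inAbove6V e p j a = 0 →
      (∀ i, p < i → inEdge6V e i j .north = false) →
      ∃ (p' : Fin n) (a' : Inc6V), OnUppermost6V e p' j a' ∧ Continues6V e p' j a' .south ∧
        (∀ i, p' < i → outEdge6V e i j .south = false) ∧
        (∀ i, p' < i → inEdge6V e i j .west = false) := by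
  induction m with
  -- The bound `m` on the number of remaining columns decreases with each step to the East.
  | zero => intro p _ hp; omega
  | succ m ih =>
    intro p a hp hon habove hN
    have hin := hon.inEdge_eq_true he
    by_cases hE : outEdge6V e p j .east = true
    · have hpn : p.val + 1 < n := by
        by_contra hlt
        have : p.succ = Fin.last n := Fin.ext (by simp; omega)
        rw [outEdge6V, this, he.right] at hE
        exact absurd hE (by simp)
      have hN' := hN ⟨p + 1, hpn⟩ (Fin.lt_def.2 (Nat.lt_succ_self _))
      refine ih ⟨p + 1, hpn⟩ .west (by simp only; omega)
        (.east p j _ a hon ⟨hin, hE, by rw [habove]; rfl⟩ rfl) ?_ fun i hi => hN i ?_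
      · rw [inAbove6V, hN', Bool.toNat_false]
      · exact lt_trans (Fin.lt_def.2 (Nat.lt_succ_self _)) hi
    · rw [Bool.not_eq_true] at hE
      have hS : outEdge6V e p j .south = true := by
        have hice := he.ice p j
        by_contra hS
        rw [Bool.not_eq_true] at hS
        rw [hE, hS] at hice
        cases a <;> simp [hin] at hice
      -- To the right of the turning node nothing enters from the North, and emptiness propagates
      -- from West to East by the ice rule.
      have hrow : ∀ k : ℕ, ∀ i : Fin n, i.val = p.val + 1 + k →
          inEdge6V e i j .west = false ∧ outEdge6V e i j .south = false := by
        intro k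
        have hstep : ∀ i : Fin n, p < i → inEdge6V e i j .west = false →
            outEdge6V e i j .south = false ∧ outEdge6V e i j .east = false := by
          intro i hi hw
          have hice := he.ice i j
          rw [hN i hi, hw, Bool.toNat_false] at hice
          constructor
          · by_contra hne
            rw [Bool.not_eq_false] at hne
            rw [hne, Bool.toNat_true] at hice
            omega
          · by_contra hne
            rw [Bool.not_eq_false] at hne
            rw [hne, Bool.toNat_true] at hice
            omega
        induction k with
        | zero =>
          intro i hi
          have hw : inEdge6V e i j .west = false := by
            have : i.castSucc = p.succ := Fin.ext (by simpa using hi)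
            rw [inEdge6V, this]
            exact hE
          exact ⟨hw, (hstep i (Fin.lt_def.2 (by omega)) hw).1⟩
        | succ k ihk =>
          intro i hi
          have hw : inEdge6V e i j .west = false := by
            have hlt : p.val + 1 + k < n := by omega
            have h0 := (ihk ⟨p.val + 1 + k, hlt⟩ rfl).1
            have : i.castSucc = (⟨p.val + 1 + k, hlt⟩ : Fin n).succ := Fin.ext (by
              simp only [Fin.val_castSucc, Fin.val_succ]; omega)
            rw [inEdge6V, this]
            exact (hstep ⟨p.val + 1 + k, hlt⟩ (Fin.lt_def.2 (by dsimp only; omega)) h0).2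
          exact ⟨hw, (hstep i (Fin.lt_def.2 (by omega)) hw).1⟩
      refine ⟨p, a, hon, ⟨hin, hS, ?_⟩, fun i hi => ?_, fun i hi => ?_⟩
      · rw [habove, outAbove6V, hE, Bool.toNat_false]
      · have := Fin.lt_def.1 hi
        exact (hrow (i - (p + 1)) i (by omega)).2
      · have := Fin.lt_def.1 hi
        exact (hrow (i - (p + 1)) i (by omega)).1

/-- Descent from the top row, `m` being the number of rows above. The condition that no path lies
above or to the right is carried along. -/
theorem exists_onUppermost6V {e : Config6V n} (he : IsConfig6V e) (m : ℕ) :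
    ∀ j : Fin n, j.val + 1 + m = n →
      ∃ (p : Fin n) (a : Inc6V), OnUppermost6V e p j a ∧ inAbove6V e p j a = 0 ∧
        ∀ i, p < i → inEdge6V e i j .north = false := by
  induction m with
  | zero =>
    intro j hj
    have hjl : j.succ = Fin.last n := Fin.ext (by simpa using hj)
    have hN : ∀ i, inEdge6V e i j .north = false := fun i => by
      rw [inEdge6V, hjl]
      exact he.top i
    exact ⟨⟨0, j.pos⟩, .west, .start _ _ rfl (by omega), by simp [inAbove6V, hN], fun i _ => hN i⟩
  | succ m ih =>
    intro j hj
    have hlt : j.val + 1 < n := by omega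
    obtain ⟨p, a, hon, habove, hN⟩ := ih ⟨j + 1, hlt⟩ (by dsimp only; omega)
    obtain ⟨p', a', hon', hcont, hS, -⟩ :=
      exists_south_of_onUppermost6V he _ n p a (by omega) hon habove hN
    refine ⟨p', .north, .south p' _ j a' hon' hcont rfl, rfl, fun i hi => ?_⟩
    exact hS i hi

/-- This replaces the uppermost path by a local edge condition, which can be transported through the
reflection. The uppermost path visits row `L`, and to the right of its descent the row is empty; so
an occupied last edge forces the descent to take place in the last column. The North edge there is
empty, hence the path came from the West. -/
theorem hitsRight6V_iff {e : Config6V n} (he : IsConfig6V e) {i : Fin n} (hi : i.val + 1 = n)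
    (L : Fin n) : HitsRight6V e L ↔ inEdge6V e i L .west = true := by
  constructor
  · rintro ⟨i', hi', hon⟩
    obtain rfl : i' = i := Fin.ext (by omega)
    exact hon.inEdge_eq_true he
  · intro hw
    have hN : inEdge6V e i L .north = false := by
      have hice := he.ice i L
      have hE : outEdge6V e i L .east = false := by
        have : i.succ = Fin.last n := Fin.ext (by simpa using hi)
        rw [outEdge6V, this]
        exact he.right L
      have haux : ∀ N S : Bool, N.toNat + true.toNat = false.toNat + S.toNat → N = false := by
        decide
      rw [hw, hE] at hice
      exact haux _ _ hice
    obtain ⟨p, a, hon, habove, hNr⟩ := exists_onUppermost6V he (n - 1 - L) L (by omega)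
    obtain ⟨p', a', hon', hcont, -, hW⟩ :=
      exists_south_of_onUppermost6V he _ n p a (by omega) hon habove hNr
    have hp' : p' = i := by
      by_contra hne
      have hne' : p'.val ≠ i.val := fun h => hne (Fin.ext h)
      have := hW i (Fin.lt_def.2 (by omega))
      rw [hw] at this
      exact absurd this (by simp)
    subst hp'
    cases a' with
    | west => exact ⟨p', hi, hon'⟩
    | north =>
      have := hon'.inEdge_eq_true he
      rw [hN] at this
      exact absurd this (by simp)

end Paths

/-! ## Weights and refined partition functions -/

theorem sixWeight_div {a : ℂ} (ha : a ≠ 0) (b cp cm : ℂ) :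
    sixWeight 1 (b / a) (cp / a) (cm / a) = fun x y p q => sixWeight a b cp cm x y p q / a := by
  funext x y p q
  cases x <;> cases y <;> cases p <;> cases q <;> simp [sixWeight, ha]

theorem triangleUpper_div (mX mY mW : Bool → Bool → Bool → Bool → ℂ) (y w : ℂ) :
    triangleUpper mX (fun h d p u => mY h d p u / y) (fun d v p u => mW d v p u / w) =
      fun h v d p q u => triangleUpper mX mY mW h v d p q u / (y * w) := by
  funext h v d p q u
  simp only [triangleUpper, Finset.sum_div]
  refine Finset.sum_congr rfl fun _ _ => Finset.sum_congr rfl fun _ _ =>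
    Finset.sum_congr rfl fun _ _ => ?_
  rw [div_mul_eq_mul_div, div_mul_div_comm, mul_comm w]

theorem triangleLower_div (mX mY mW : Bool → Bool → Bool → Bool → ℂ) (y w : ℂ) :
    triangleLower mX (fun h d p u => mY h d p u / y) (fun d v p u => mW d v p u / w) =
      fun h v d p q u => triangleLower mX mY mW h v d p q u / (y * w) := by
  funext h v d p q u
  simp only [triangleLower, Finset.sum_div]
  refine Finset.sum_congr rfl fun _ _ => Finset.sum_congr rfl fun _ _ =>
    Finset.sum_congr rfl fun _ _ => ?_
  rw [div_mul_eq_mul_div, div_mul_div_comm]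

/-- The crossings with a diagonal are normalized to have weight 1 on empty or full pairs, as
freezing requires; both sides of the equation scale alike. -/
theorem yangBaxter_div {s k a3 b3 A B a2 b2 cm : ℂ} (hs : s ≠ 0) (ha2 : a2 ≠ 0) (ha3 : a3 ≠ 0)
    (h3 : a3 ^ 2 + b3 ^ 2 - 2 * k * a3 * b3 = s ^ 2)
    (h2a : s * a2 = B * b3 - A * (2 * k * b3 - a3)) (h2b : s * b2 = B * a3 - A * b3)
    (hcm : s * cm = A ^ 2 + B ^ 2 - 2 * k * A * B) :
    triangleUpper (sixWeight A B s cm) (sixWeight 1 (b2 / a2) (s / a2) (cm / a2))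
        (sixWeight 1 (b3 / a3) (s / a3) (s / a3)) =
      triangleLower (sixWeight A B s cm) (sixWeight 1 (b2 / a2) (s / a2) (cm / a2))
        (sixWeight 1 (b3 / a3) (s / a3) (s / a3)) := by
  rw [sixWeight_div ha2, sixWeight_div ha3, triangleUpper_div, triangleLower_div]
  funext h v d p q u
  rw [yangBaxter hs h3 h2a h2b hcm]

theorem sixWeight_eq_zero (a b cp cm : ℂ) {x y p q : Bool}
    (h : x.toNat + y.toNat ≠ p.toNat + q.toNat) : sixWeight a b cp cm x y p q = 0 := by
  cases x <;> cases y <;> cases p <;> cases q <;> first | rfl | exact absurd rfl h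

theorem triangleUpper_eq_zero {mX mY mW : Bool → Bool → Bool → Bool → ℂ}
    (hX : ∀ x y p q : Bool, x.toNat + y.toNat ≠ p.toNat + q.toNat → mX x y p q = 0)
    (hY : ∀ x y p q : Bool, x.toNat + y.toNat ≠ p.toNat + q.toNat → mY x y p q = 0)
    (hW : ∀ x y p q : Bool, x.toNat + y.toNat ≠ p.toNat + q.toNat → mW x y p q = 0)
    {h v d p q u : Bool}
    (hne : h.toNat + v.toNat + d.toNat ≠ p.toNat + q.toNat + u.toNat) :
    triangleUpper mX mY mW h v d p q u = 0 := by
  refine Finset.sum_eq_zero fun d' _ => Finset.sum_eq_zero fun v' _ =>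
    Finset.sum_eq_zero fun h' _ => ?_
  by_cases h1 : d.toNat + v.toNat = d'.toNat + v'.toNat
  · by_cases h2 : h.toNat + v'.toNat = h'.toNat + q.toNat
    · rw [hY _ _ _ _ (by omega), mul_zero]
    · rw [hX _ _ _ _ h2, mul_zero, zero_mul]
  · rw [hW _ _ _ _ h1, zero_mul, zero_mul]

set_option maxHeartbeats 1000000 in
/-- The weights of the 20V model are those of a triangle of three six-vertex crossings. -/
theorem triangleUpper_eq_weight20V {s k a1 b1 a2 b2 a3 b3 : ℂ} (hs : s ≠ 0)
    (h1 : a1 ^ 2 + b1 ^ 2 - 2 * k * a1 * b1 = s ^ 2)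
    (h3 : a3 ^ 2 + b3 ^ 2 - 2 * k * a3 * b3 = s ^ 2)
    (h2a : s * a2 = b1 * b3 - a1 * (2 * k * b3 - a3)) (h2b : s * b2 = b1 * a3 - a1 * b3)
    {ω : Fin 7 → ℂ} (hω0 : ω 0 = a1 * a3 * a2) (hω1 : ω 1 = b1 * b3 * a2)
    (hω2 : ω 2 = s * b1 * a2) (hω3 : ω 3 = s ^ 3 + a1 * b3 * b2) (hω4 : ω 4 = s * a3 * a2)
    (hω5 : ω 5 = s * b1 * a3) (hω6 : ω 6 = b1 * a3 * b2) (h v d p q u : Bool) :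
    triangleUpper (sixWeight a1 b1 s s) (sixWeight a2 b2 s s) (sixWeight a3 b3 s s) h v d p q u =
      weight20V ω v d h p u q := by
  -- The star-triangle relations again: they are needed where a triangle sum has two terms while the
  -- prescribed weight is a single product.
  have e1 : b1 * a2 = a1 * b2 + s * b3 := by
    refine mul_left_cancel₀ hs ?_
    linear_combination b1 * h2a - a1 * h2b + b3 * h1
  have e2 : s * a1 + b3 * b2 = a2 * a3 := by
    refine mul_left_cancel₀ hs ?_
    linear_combination b3 * h2b - a3 * h2a - a1 * h3
  cases h <;> cases v <;> cases d <;> cases p <;> cases q <;> cases u <;>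
    simp only [triangleUpper, Fintype.sum_bool, sixWeight, mul_zero, zero_mul, add_zero, zero_add,
      weight20V, hω0, hω1, hω2, hω3, hω4, hω5, hω6]
  all_goals first
    | ring1
    | linear_combination s * e1
    | linear_combination (-s) * e1
    | linear_combination s * e2
    | linear_combination (-s) * e2
    | linear_combination s * h2b

theorem prod_leaving_factor {n : ℕ} (L : Fin n) (τ x : ℂ) :
    ∏ i : Fin n, (if i.val < L.val then τ else if i.val = L.val then x else 1) =
      τ ^ L.val * x := by
  have h : ∀ i : Fin n, (if i.val < L.val then τ else if i.val = L.val then x else 1) =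
      (if i < L then τ else 1) * (if i = L then x else 1) := by
    intro i
    simp only [Fin.lt_def, Fin.ext_iff]
    split_ifs <;> first | omega | simp
  simp only [h, Finset.prod_mul_distrib, Finset.prod_ite_eq', Finset.mem_univ, if_true]
  rw [Finset.prod_ite, Finset.prod_const_one, mul_one, Finset.prod_const]
  congr 2
  rw [← Fin.card_Iio L]
  congr 1
  ext i
  simp

theorem rev_val_eq_zero_iff {n : ℕ} {j jt : Fin n} (hj : jt.val + 1 = n) :
    j.rev.val = 0 ↔ j = jt := by
  rw [Fin.val_rev, Fin.ext_iff]
  omega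

/-! ### Changing the parameter of the top line. -/

section Main

variable {n : ℕ} {s k a1 b1 a2 b2 a3 b3 α β σ cm : ℂ}

/-- The weights of the crossings of horizontal and vertical lines when the parameter of the top
line is changed. -/
def topX (a1 b1 s σ cm : ℂ) (r : ℕ) : Bool → Bool → Bool → Bool → ℂ :=
  if r = 0 then sixWeight a1 (σ * b1) s cm else sixWeight a1 b1 s s

/-- The weights of the crossings of horizontal and diagonal lines when the parameter of the top
line is changed. -/
noncomputable def topY (a2 b2 s α β cm : ℂ) (r : ℕ) : Bool → Bool → Bool → Bool → ℂ :=
  if r = 0 then sixWeight 1 (β / α) (s / α) (cm / α) else sixWeight 1 (b2 / a2) (s / a2) (s / a2)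

/-- After multiplication by `a2 * a3`, the top row weights are `σ b1 a3 β a2 / α` for (W,E), `s a3
a2` for (W,S), `σ b1 s a3 a2 / α` for (W,SE) and `a1 a3 a2` for an empty node. Division by ω₆, ω₄,
ω₅, ω₀ leaves the factors τ, 1, `σ a2 / α`, 1. The weight `cm` does not occur, because no path
enters the top row from the North or the Northwest. The other rows give exactly the 20V weights. -/
theorem prod_triangle_eq (hs : s ≠ 0) (ha2 : a2 ≠ 0) (hb2 : b2 ≠ 0) (ha3 : a3 ≠ 0) (hα : α ≠ 0)
    (h1 : a1 ^ 2 + b1 ^ 2 - 2 * k * a1 * b1 = s ^ 2)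
    (h3 : a3 ^ 2 + b3 ^ 2 - 2 * k * a3 * b3 = s ^ 2)
    (h2a : s * a2 = b1 * b3 - a1 * (2 * k * b3 - a3)) (h2b : s * b2 = b1 * a3 - a1 * b3)
    {ω : Fin 7 → ℂ} (hω0 : ω 0 = a1 * a3 * a2) (hω1 : ω 1 = b1 * b3 * a2)
    (hω2 : ω 2 = s * b1 * a2) (hω3 : ω 3 = s ^ 3 + a1 * b3 * b2) (hω4 : ω 4 = s * a3 * a2)
    (hω5 : ω 5 = s * b1 * a3) (hω6 : ω 6 = b1 * a3 * b2)
    {c : Config n} {jt : Fin n} (hj : jt.val + 1 = n) {L : Fin n} {b : Bool}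
    (hW : ∀ i, inEdge c i jt .west = decide (i.val ≤ L.val))
    (hN : ∀ i, inEdge c i jt .north = false) (hNW : ∀ i, inEdge c i jt .northwest = false)
    (hE : ∀ i, outEdge c i jt .east = decide (i.val < L.val))
    (hSE : ∀ i, outEdge c i jt .southeast = (decide (i.val = L.val) && b))
    (hS : ∀ i, outEdge c i jt .south = (decide (i.val = L.val) && !b)) :
    (a2 * a3) ^ (n ^ 2) * (∏ i : Fin n, ∏ j : Fin n,
        triangleUpper (topX a1 b1 s σ cm j.rev) (topY a2 b2 s α β cm j.rev)
          (sixWeight 1 (b3 / a3) (s / a3) (s / a3)) (inEdge c i j .west) (inEdge c i j .north)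
          (inEdge c i j .northwest) (outEdge c i j .east) (outEdge c i j .south)
          (outEdge c i j .southeast)) =
      (σ * β * a2 / (b2 * α)) ^ L.val * (if b then σ * a2 / α else 1) * totalWeight20V ω c := by
  set τ := σ * β * a2 / (b2 * α) with hτ
  have hconst : (a2 * a3) ^ (n ^ 2) = ∏ _i : Fin n, ∏ _j : Fin n, (a2 * a3) := by
    simp only [Finset.prod_const, Finset.card_univ, Fintype.card_fin]
    rw [← pow_mul, sq]
  have hfac : τ ^ L.val * (if b then σ * a2 / α else 1) = ∏ i : Fin n, ∏ j : Fin n,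
      (if j = jt then (if i.val < L.val then τ else if i.val = L.val then
        (if b then σ * a2 / α else 1) else 1) else 1) := by
    simp only [Finset.prod_ite_eq', Finset.mem_univ, if_true, prod_leaving_factor]
  rw [hconst, hfac, totalWeight20V]
  simp only [← Finset.prod_mul_distrib]
  refine Finset.prod_congr rfl fun i _ => Finset.prod_congr rfl fun j _ => ?_
  by_cases hjt : j = jt
  · have hr : j.rev.val = 0 := (rev_val_eq_zero_iff hj).2 hjt
    rw [if_pos hjt, topX, topY, if_pos hr, if_pos hr, sixWeight_div hα, sixWeight_div ha3,
      triangleUpper_div, hjt, hW, hN, hNW, hE, hSE, hS]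
    rcases lt_trichotomy i.val L.val with hlt | heq | hgt
    · rw [if_pos hlt]
      simp only [hlt, hlt.le, hlt.ne, decide_true, decide_false, Bool.false_and, triangleUpper,
        Fintype.sum_bool, sixWeight, mul_zero, zero_mul, add_zero, zero_add, weight20V, hω6, hτ]
      field_simp
    · rw [if_neg (by omega), if_pos heq]
      cases b
      · simp [heq, triangleUpper, sixWeight, weight20V, hω4]
        field_simp
      · simp [heq, triangleUpper, sixWeight, weight20V, hω5]
        field_simp
    · rw [if_neg (by omega), if_neg (by omega)]
      have h4 : ¬ i.val ≤ L.val := by omega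
      have h5 : ¬ i.val < L.val := by omega
      have h6 : ¬ i.val = L.val := by omega
      simp only [h4, h5, h6, decide_false, Bool.false_and, triangleUpper,
        Fintype.sum_bool, sixWeight, mul_zero, zero_mul, zero_add, weight20V, hω0]
      field_simp
  · have hr : j.rev.val ≠ 0 := fun h => hjt ((rev_val_eq_zero_iff hj).1 h)
    rw [if_neg hjt, topX, topY, if_neg hr, if_neg hr, sixWeight_div ha2, sixWeight_div ha3,
      triangleUpper_div]
    beta_reduce
    rw [triangleUpper_eq_weight20V hs h1 h3 h2a h2b hω0 hω1 hω2 hω3 hω4 hω5 hω6, one_mul]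
    exact mul_div_cancel₀ _ (mul_ne_zero ha2 ha3)

theorem triangle_topX_topY_eq_zero (r : ℕ) {h v d p q u : Bool}
    (hne : h.toNat + v.toNat + d.toNat ≠ p.toNat + q.toNat + u.toNat) :
    triangleUpper (topX a1 b1 s σ cm r) (topY a2 b2 s α β cm r)
      (sixWeight 1 (b3 / a3) (s / a3) (s / a3)) h v d p q u = 0 := by
  refine triangleUpper_eq_zero ?_ ?_ (fun _ _ _ _ h => sixWeight_eq_zero _ _ _ _ h) hne
  · intro x y p q h
    unfold topX
    split_ifs <;> exact sixWeight_eq_zero _ _ _ _ h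
  · intro x y p q h
    unfold topY
    split_ifs <;> exact sixWeight_eq_zero _ _ _ _ h

-- Configurations violating the ice rule have weight zero; each of the others has exactly one
-- leaving column and one type of leaving step, so a single term of the generating functions
-- survives.
open Classical in
theorem sum_triangle_eq_refined (hn : 1 ≤ n) (hs : s ≠ 0) (ha2 : a2 ≠ 0) (hb2 : b2 ≠ 0)
    (ha3 : a3 ≠ 0) (hα : α ≠ 0)
    (h1 : a1 ^ 2 + b1 ^ 2 - 2 * k * a1 * b1 = s ^ 2)
    (h3 : a3 ^ 2 + b3 ^ 2 - 2 * k * a3 * b3 = s ^ 2)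
    (h2a : s * a2 = b1 * b3 - a1 * (2 * k * b3 - a3)) (h2b : s * b2 = b1 * a3 - a1 * b3)
    {ω : Fin 7 → ℂ} (hω0 : ω 0 = a1 * a3 * a2) (hω1 : ω 1 = b1 * b3 * a2)
    (hω2 : ω 2 = s * b1 * a2) (hω3 : ω 3 = s ^ 3 + a1 * b3 * b2) (hω4 : ω 4 = s * a3 * a2)
    (hω5 : ω 5 = s * b1 * a3) (hω6 : ω 6 = b1 * a3 * b2) :
    (a2 * a3) ^ (n ^ 2) * (∑ c : Config n, if DWBC2 c then ∏ i : Fin n, ∏ j : Fin n,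
        triangleUpper (topX a1 b1 s σ cm j.rev) (topY a2 b2 s α β cm j.rev)
          (sixWeight 1 (b3 / a3) (s / a3) (s / a3)) (inEdge c i j .west) (inEdge c i j .north)
          (inEdge c i j .northwest) (outEdge c i j .east) (outEdge c i j .south)
          (outEdge c i j .southeast) else 0) =
      ZtopRefined n ω .south (σ * β * a2 / (b2 * α)) +
        σ * a2 / α * ZtopRefined n ω .southeast (σ * β * a2 / (b2 * α)) := by
  simp only [ZtopRefined, Ztop, Finset.sum_mul, Finset.mul_sum]
  rw [Finset.sum_comm, Finset.sum_comm (f := fun (L : Fin n) (c : Config n) => σ * a2 / α *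
    ((if IsConfig20V c ∧ LeavesTop c L .southeast then totalWeight20V ω c else 0) *
      (σ * β * a2 / (b2 * α)) ^ L.val)), ← Finset.sum_add_distrib]
  refine Finset.sum_congr rfl fun c _ => ?_
  by_cases hc : IsConfig20V c
  · have hj : (⟨n - 1, by omega⟩ : Fin n).val + 1 = n := by
      dsimp only
      omega
    obtain ⟨L, b, hW, hN, hNW, hE, hSE, hS⟩ := exists_topRow hc hj
    have hl := leavesTop_iff hj hW hN hNW hE hSE hS
    rw [if_pos hc.1, prod_triangle_eq hs ha2 hb2 ha3 hα h1 h3 h2a h2b hω0 hω1 hω2 hω3 hω4 hω5 hω6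
      hj hW hN hNW hE hSE hS]
    have hl1 := fun L' => hl L' false
    have hl2 := fun L' => hl L' true
    simp only [leavingStep] at hl1 hl2
    simp only [hc, true_and, hl1, hl2]
    cases b
    · simp [ite_mul]
      ring
    · simp [ite_mul]
      ring
  · simp only [hc, false_and, if_false, zero_mul, mul_zero, Finset.sum_const_zero, add_zero]
    by_cases hb : DWBC2 c
    · rw [if_pos hb]
      have hice : ¬ ∀ i j, IceRule c i j := fun h => hc ⟨hb, h⟩
      push Not at hice
      obtain ⟨i, j, hij⟩ := hice
      refine mul_eq_zero_of_right _ (Finset.prod_eq_zero (Finset.mem_univ i)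
        (Finset.prod_eq_zero (Finset.mem_univ j) (triangle_topX_topY_eq_zero _ fun h => hij ?_)))
      rw [IceRule]
      omega
    · rw [if_neg hb, mul_zero]

theorem exists_topRow6V {e : Config6V n} (he : IsConfig6V e) {j : Fin n} (hj : j.val + 1 = n) :
    ∃ L : Fin n, (∀ i, inEdge6V e i j .west = decide (i.val ≤ L.val)) ∧
      (∀ i, inEdge6V e i j .north = false) ∧
      (∀ i, outEdge6V e i j .east = decide (i.val < L.val)) ∧
      (∀ i, outEdge6V e i j .south = decide (i.val = L.val)) := by
  have hjl : j.succ = Fin.last n := Fin.ext (by simpa using hj)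
  have hN : ∀ i, inEdge6V e i j .north = false := fun i => by
    rw [inEdge6V, hjl]
    exact he.top i
  have haux : ∀ w e s : Bool, false.toNat + w.toNat = e.toNat + s.toNat →
      (e = true → w = true) ∧ s = (w && !e) := by decide
  have hice : ∀ i, (outEdge6V e i j .east = true → inEdge6V e i j .west = true) ∧
      outEdge6V e i j .south = (inEdge6V e i j .west && !outEdge6V e i j .east) := fun i =>
    haux _ _ _ (by rw [← hN i]; exact he.ice i j)
  obtain ⟨L, hL⟩ := exists_eq_decide_le (h := fun k => e.1 k j) (he.left j) (he.right j)
    fun i => (hice i).1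
  have hW : ∀ i, inEdge6V e i j .west = decide (i.val ≤ L.val) := fun i => by
    simpa [inEdge6V] using hL i.castSucc
  have hE : ∀ i, outEdge6V e i j .east = decide (i.val < L.val) := fun i => by
    simpa [outEdge6V, Nat.succ_le_iff] using hL i.succ
  refine ⟨L, hW, hN, hE, fun i => ?_⟩
  rw [(hice i).2, hW, hE, ← decide_not, ← Bool.decide_and, decide_eq_decide]
  omega

/-- In the top row the path goes straight `L.val` times, gaining σ each time, and then turns South
with the unchanged weight `s`; a turn from North to East, of weight `cm`, cannot occur there. -/
theorem prod_topX_eq {e : Config6V n} {jt : Fin n} (hj : jt.val + 1 = n) {L : Fin n}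
    (hW : ∀ i, inEdge6V e i jt .west = decide (i.val ≤ L.val))
    (hN : ∀ i, inEdge6V e i jt .north = false)
    (hE : ∀ i, outEdge6V e i jt .east = decide (i.val < L.val))
    (hS : ∀ i, outEdge6V e i jt .south = decide (i.val = L.val)) :
    (∏ i : Fin n, ∏ j : Fin n, topX a1 b1 s σ cm j.rev (inEdge6V e i j .west)
      (inEdge6V e i j .north) (outEdge6V e i j .east) (outEdge6V e i j .south)) =
      σ ^ L.val * ∏ i : Fin n, ∏ j : Fin n, weight6V a1 b1 s (inEdge6V e i j .north)
        (inEdge6V e i j .west) (outEdge6V e i j .east) (outEdge6V e i j .south) := by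
  have hfac : σ ^ L.val = ∏ i : Fin n, ∏ j : Fin n,
      (if j = jt then (if i.val < L.val then σ else if i.val = L.val then 1 else 1) else 1) := by
    simp only [Finset.prod_ite_eq', Finset.mem_univ, if_true, prod_leaving_factor, mul_one]
  rw [hfac]
  simp only [← Finset.prod_mul_distrib]
  refine Finset.prod_congr rfl fun i _ => Finset.prod_congr rfl fun j _ => ?_
  by_cases hjt : j = jt
  · have hr : j.rev.val = 0 := (rev_val_eq_zero_iff hj).2 hjt
    rw [if_pos hjt, topX, if_pos hr, hjt, hW, hN, hE, hS]
    rcases lt_trichotomy i.val L.val with hlt | heq | hgt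
    · simp [hlt, hlt.le, hlt.ne, sixWeight, weight6V]
    · simp [heq, sixWeight, weight6V]
    · have h4 : ¬ i.val ≤ L.val := by omega
      have h5 : ¬ i.val < L.val := by omega
      have h6 : ¬ i.val = L.val := by omega
      simp only [h4, h5, h6, decide_false, if_false, sixWeight, weight6V, one_mul]
  · have hr : j.rev.val ≠ 0 := fun h => hjt ((rev_val_eq_zero_iff hj).1 h)
    rw [if_neg hjt, topX, if_neg hr, one_mul]
    have haux : ∀ N W E S : Bool, sixWeight a1 b1 s s W N E S = weight6V a1 b1 s N W E S := by
      intro N W E S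
      cases N <;> cases W <;> cases E <;> cases S <;> rfl
    exact haux _ _ _ _

-- By reflection, the column where the path leaves the top row becomes the row where the uppermost
-- path hits the last column.
open Classical in
theorem sum_topX_eq_refined (hn : 1 ≤ n) :
    (∑ e : Config6V n, if DWBC6V e then ∏ i : Fin n, ∏ j : Fin n,
        topX a1 b1 s σ cm j.rev (inEdge6V e i j .west) (inEdge6V e i j .north)
          (outEdge6V e i j .east) (outEdge6V e i j .south) else 0) =
      ∑ L : Fin n, Z6V n a1 b1 s L * σ ^ L.val := by
  have hj : (⟨n - 1, by omega⟩ : Fin n).val + 1 = n := by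
    dsimp only
    omega
  generalize (⟨n - 1, by omega⟩ : Fin n) = jt at hj
  simp only [Z6V, Finset.sum_mul]
  rw [Finset.sum_comm, ← (transpose6V n).sum_comp (fun e => ∑ L : Fin n, _ * _)]
  refine Finset.sum_congr rfl fun e _ => ?_
  rw [isConfig6V_transpose_iff, prod_weight6V_transpose]
  by_cases he : IsConfig6V e
  · obtain ⟨L, hW, hN, hE, hS⟩ := exists_topRow6V he hj
    have hhit : ∀ L', HitsRight6V (transpose6V n e) L' ↔ L' = L := by
      intro L'
      rw [hitsRight6V_iff (isConfig6V_transpose he) hj]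
      change outEdge6V e L' jt .south = true ↔ _
      rw [hS, decide_eq_true_eq, Fin.ext_iff]
    rw [if_pos ⟨he.left, he.right, he.bottom, he.top⟩, prod_topX_eq hj hW hN hE hS]
    simp only [he, true_and, hhit, ite_mul, zero_mul, Finset.sum_ite_eq', Finset.mem_univ, if_true]
    ring
  · simp only [he, false_and, if_false, zero_mul, Finset.sum_const_zero]
    by_cases hb : DWBC6V e
    · rw [if_pos hb]
      have hice : ¬ ∀ i j, (inEdge6V e i j .north).toNat + (inEdge6V e i j .west).toNat =
          (outEdge6V e i j .east).toNat + (outEdge6V e i j .south).toNat :=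
        fun h => he ⟨hb.left, hb.right, hb.bottom, hb.top, h⟩
      push Not at hice
      obtain ⟨i, j, hij⟩ := hice
      refine Finset.prod_eq_zero (Finset.mem_univ i) (Finset.prod_eq_zero (Finset.mem_univ j) ?_)
      unfold topX
      split_ifs <;> exact sixWeight_eq_zero _ _ _ _ (by omega)
    · rw [if_neg hb]

/-- The relation between the refined partition functions, for weights given by their algebraic
relations. -/
theorem refined_eq_of_relations (hn : 1 ≤ n) (hs : s ≠ 0) (ha2 : a2 ≠ 0) (hb2 : b2 ≠ 0)
    (ha3 : a3 ≠ 0) (hα : α ≠ 0)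
    (h1 : a1 ^ 2 + b1 ^ 2 - 2 * k * a1 * b1 = s ^ 2)
    (h3 : a3 ^ 2 + b3 ^ 2 - 2 * k * a3 * b3 = s ^ 2)
    (h2a : s * a2 = b1 * b3 - a1 * (2 * k * b3 - a3)) (h2b : s * b2 = b1 * a3 - a1 * b3)
    (hsα : s * α = σ * b1 * b3 - a1 * (2 * k * b3 - a3)) (hsβ : s * β = σ * b1 * a3 - a1 * b3)
    {ω : Fin 7 → ℂ} (hω0 : ω 0 = a1 * a3 * a2) (hω1 : ω 1 = b1 * b3 * a2)
    (hω2 : ω 2 = s * b1 * a2) (hω3 : ω 3 = s ^ 3 + a1 * b3 * b2) (hω4 : ω 4 = s * a3 * a2)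
    (hω5 : ω 5 = s * b1 * a3) (hω6 : ω 6 = b1 * a3 * b2) :
    ZtopRefined n ω .south (σ * β * a2 / (b2 * α)) +
        σ * a2 / α * ZtopRefined n ω .southeast (σ * β * a2 / (b2 * α)) =
      (a2 * a3) ^ (n ^ 2) * ∑ L : Fin n, Z6V n a1 b1 s L * σ ^ L.val := by
  -- The free turning weight restores the anisotropy `k` on the top line after `b1` has become `σ *
  -- b1`; this makes every σ admissible.
  set cm : ℂ := (a1 ^ 2 + (σ * b1) ^ 2 - 2 * k * a1 * (σ * b1)) / s with hcm
  rw [← sum_triangle_eq_refined (cm := cm) hn hs ha2 hb2 ha3 hα h1 h3 h2a h2b hω0 hω1 hω2 hω3 hω4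
    hω5 hω6, ← sum_topX_eq_refined (cm := cm) hn, sum_triangle_eq_sum_six]
  · intro r
    unfold topX topY
    split_ifs
    · exact yangBaxter_div hs hα ha3 h3 hsα hsβ (mul_div_cancel₀ _ hs)
    · exact yangBaxter_div hs ha2 ha3 h3 h2a h2b (by rw [h1, sq])
  · intro r
    unfold topY
    split_ifs <;> exact isFrozen_sixWeight _ _ _
  · exact isFrozen_sixWeight _ _ _

end Main

/-! ## Trigonometric parametrization -/

/-- Anisotropy relation with k = cos φ. It applies to (a1, b1) and to (a3, b3), whose angles differ
by φ = 2η. -/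
theorem sin_add_sq_relation (x φ : ℂ) :
    Complex.sin (x + φ) ^ 2 + Complex.sin x ^ 2 -
      2 * Complex.cos φ * Complex.sin (x + φ) * Complex.sin x = Complex.sin φ ^ 2 := by
  rw [Complex.sin_add]
  linear_combination Complex.sin φ ^ 2 * Complex.sin_sq_add_cos_sq x -
    Complex.sin x ^ 2 * Complex.sin_sq_add_cos_sq φ

/-- With `y` and `u` the angles of b1 and b3, this and `sin_mul_sin_sub` express a2 and b2 through
the other weights. -/
theorem sin_mul_sin_sub_add (y u φ : ℂ) : Complex.sin φ * Complex.sin (y - u + φ) =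
    Complex.sin y * Complex.sin u - Complex.sin (y + φ) * Complex.sin (u - φ) := by
  simp only [Complex.sin_add, Complex.sin_sub, Complex.cos_sub]
  linear_combination Complex.sin y * Complex.sin u * Complex.sin_sq_add_cos_sq φ

theorem sin_mul_sin_sub (y u φ : ℂ) : Complex.sin φ * Complex.sin (y - u) =
    Complex.sin y * Complex.sin (u + φ) - Complex.sin (y + φ) * Complex.sin u := by
  simp only [Complex.sin_add, Complex.sin_sub]
  ring

theorem exp_sub_exp_eq_sin (x y : ℂ) : Complex.exp (Complex.I * x) - Complex.exp (Complex.I * y) =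
    2 * Complex.I * Complex.exp (Complex.I * ((x + y) / 2)) * Complex.sin ((x - y) / 2) := by
  have h1 : Complex.exp (Complex.I * x) = Complex.exp (Complex.I * ((x + y) / 2)) *
      Complex.exp ((x - y) / 2 * Complex.I) := by
    rw [← Complex.exp_add]
    ring_nf
  have h2 : Complex.exp (Complex.I * y) = Complex.exp (Complex.I * ((x + y) / 2)) *
      Complex.exp (-((x - y) / 2) * Complex.I) := by
    rw [← Complex.exp_add]
    ring_nf
  rw [h1, h2, Complex.sin]
  linear_combination (Complex.exp (Complex.I * ((x + y) / 2)) *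
    (Complex.exp ((x - y) / 2 * Complex.I) - Complex.exp (-((x - y) / 2) * Complex.I))) *
    Complex.I_sq

/-- Each exponential difference is a phase times a sine. The two phases multiply to t, which cancels
the three factors t^{1/3}, leaving the product of the trigonometric weights a2 and a3 of the
triangle. -/
theorem a₂_mul_a₃_div (η lam μ : ℂ) : a₂ η lam μ * a₃ η lam μ / tCubeRoot μ =
    Complex.sin ((lam + 3 * η - μ) / 2) * Complex.sin ((lam + 3 * η + μ) / 2) := by
  have ht0 : tCubeRoot μ ≠ 0 := Complex.exp_ne_zero _
  have ht : Complex.exp (Complex.I * ((lam + η + μ) / 2)) *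
      Complex.exp (Complex.I * ((μ - η - lam) / 2)) = tCubeRoot μ ^ 3 := by
    rw [tCubeRoot, ← Complex.exp_add, ← Complex.exp_nat_mul]
    congr 1
    push_cast
    ring
  have h2 : Complex.exp (Complex.I * η) * Complex.exp (Complex.I * (η + lam)) -
      (Complex.exp (Complex.I * η))⁻¹ * Complex.exp (Complex.I * μ) =
      2 * Complex.I * Complex.exp (Complex.I * ((lam + η + μ) / 2)) *
        Complex.sin ((lam + 3 * η - μ) / 2) := by
    have := exp_sub_exp_eq_sin (2 * η + lam) (μ - η)
    rw [show 2 * η + lam + (μ - η) = lam + η + μ by ring,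
      show 2 * η + lam - (μ - η) = lam + 3 * η - μ by ring] at this
    rw [← this, ← Complex.exp_neg, ← Complex.exp_add, ← Complex.exp_add]
    ring_nf
  have h3 : Complex.exp (Complex.I * η) * Complex.exp (Complex.I * μ) -
      (Complex.exp (Complex.I * η))⁻¹ * Complex.exp (-(Complex.I * (η + lam))) =
      2 * Complex.I * Complex.exp (Complex.I * ((μ - η - lam) / 2)) *
        Complex.sin ((lam + 3 * η + μ) / 2) := by
    have := exp_sub_exp_eq_sin (η + μ) (-(2 * η + lam))
    rw [show η + μ + -(2 * η + lam) = μ - η - lam by ring,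
      show η + μ - -(2 * η + lam) = lam + 3 * η + μ by ring] at this
    rw [← this, ← Complex.exp_neg, ← Complex.exp_add, ← Complex.exp_add]
    ring_nf
  have hI : Complex.I ≠ 0 := Complex.I_ne_zero
  rw [a₂, a₃, h2, h3]
  generalize Complex.exp (Complex.I * ((lam + η + μ) / 2)) = x at *
  generalize Complex.exp (Complex.I * ((μ - η - lam) / 2)) = y at *
  generalize Complex.sin ((lam + 3 * η - μ) / 2) = a
  generalize Complex.sin ((lam + 3 * η + μ) / 2) = b
  field_simp
  linear_combination a * b * ht

end TwentyV

theorem theorem3p2 (n : ℕ) (hn : 1 ≤ n) (η lam μ : ℝ)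
    (hη : 0 < η) (hηlam : η < lam) (hlam : lam < Real.pi - η)
    (hμ : η - lam < μ) (hμ' : μ < lam - η)
    (σ : ℂ) (hσ : TwentyV.denomTilde η lam μ σ ≠ 0) :
    TwentyV.ZtopRefined n (TwentyV.omega η lam μ) .south (TwentyV.tauTilde η lam μ σ) +
        TwentyV.gTilde η lam μ σ *
          TwentyV.ZtopRefined n (TwentyV.omega η lam μ) .southeast (TwentyV.tauTilde η lam μ σ) =
      (TwentyV.a₂ η lam μ * TwentyV.a₃ η lam μ / TwentyV.tCubeRoot μ) ^ (n ^ 2) *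
        TwentyV.Z6VRefined n η lam σ := by
  have hsin : ∀ x : ℝ, 0 < x → x < Real.pi → Complex.sin (x : ℂ) ≠ 0 := by
    intro x h0 h1
    rw [← Complex.ofReal_sin]
    exact_mod_cast (Real.sin_pos_of_pos_of_lt_pi h0 h1).ne'
  have hs : Complex.sin (2 * (η : ℂ)) ≠ 0 := by
    have := hsin (2 * η) (by linarith) (by linarith)
    push_cast at this
    exact this
  have ha2 : Complex.sin (((lam : ℂ) + 3 * η - μ) / 2) ≠ 0 := by
    have := hsin ((lam + 3 * η - μ) / 2) (by linarith) (by linarith)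
    push_cast at this
    exact this
  have ha3 : Complex.sin (((lam : ℂ) + 3 * η + μ) / 2) ≠ 0 := by
    have := hsin ((lam + 3 * η + μ) / 2) (by linarith) (by linarith)
    push_cast at this
    exact this
  have hb2 : Complex.sin (((lam : ℂ) - η - μ) / 2) ≠ 0 := by
    have := hsin ((lam - η - μ) / 2) (by linarith) (by linarith)
    push_cast at this
    exact this
  have h1 := TwentyV.sin_add_sq_relation ((lam : ℂ) - η) (2 * η)
  have h3 := TwentyV.sin_add_sq_relation (((lam : ℂ) - η + μ) / 2) (2 * η)
  have h2a := TwentyV.sin_mul_sin_sub_add ((lam : ℂ) - η) (((lam : ℂ) - η + μ) / 2) (2 * η)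
  have h2b := TwentyV.sin_mul_sin_sub ((lam : ℂ) - η) (((lam : ℂ) - η + μ) / 2) (2 * η)
  -- The angle with 5η is one more shift by 2η: its sine is `2 k b3 - a3`, which identifies the
  -- denominator D with `s * α`.
  have hd : Complex.sin (((lam : ℂ) - 5 * η + μ) / 2) =
      2 * Complex.cos (2 * η) * Complex.sin (((lam : ℂ) - η + μ) / 2) -
        Complex.sin (((lam : ℂ) + 3 * η + μ) / 2) := by
    rw [show ((lam : ℂ) - 5 * η + μ) / 2 = (lam - η + μ) / 2 - 2 * η by ring,
      show ((lam : ℂ) + 3 * η + μ) / 2 = (lam - η + μ) / 2 + 2 * η by ring,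
      Complex.sin_sub, Complex.sin_add]
    ring
  rw [show (lam : ℂ) - η + 2 * η = lam + η by ring] at h1 h2a h2b
  rw [show ((lam : ℂ) - η + μ) / 2 + 2 * η = (lam + 3 * η + μ) / 2 by ring] at h3 h2b
  rw [show (lam : ℂ) - η - (lam - η + μ) / 2 + 2 * η = (lam + 3 * η - μ) / 2 by ring,
    show ((lam : ℂ) - η + μ) / 2 - 2 * η = (lam - 5 * η + μ) / 2 by ring, hd] at h2a
  rw [show (lam : ℂ) - η - (lam - η + μ) / 2 = (lam - η - μ) / 2 by ring] at h2b
  have hD : TwentyV.denomTilde η lam μ σ = σ * Complex.sin ((lam : ℂ) - η) *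
      Complex.sin (((lam : ℂ) - η + μ) / 2) - Complex.sin ((lam : ℂ) + η) *
      (2 * Complex.cos (2 * η) * Complex.sin (((lam : ℂ) - η + μ) / 2) -
        Complex.sin (((lam : ℂ) + 3 * η + μ) / 2)) := by
    rw [TwentyV.denomTilde, hd]
  have key := TwentyV.refined_eq_of_relations (n := n) (σ := σ)
    (α := TwentyV.denomTilde η lam μ σ / Complex.sin (2 * η))
    (β := (σ * Complex.sin ((lam : ℂ) - η) * Complex.sin (((lam : ℂ) + 3 * η + μ) / 2) -
      Complex.sin ((lam : ℂ) + η) * Complex.sin (((lam : ℂ) - η + μ) / 2)) / Complex.sin (2 * η))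
    (ω := TwentyV.omega η lam μ) hn hs ha2 hb2 ha3 (div_ne_zero hσ hs) h1 h3 h2a h2b
    (by rw [mul_div_cancel₀ _ hs, hD]) (mul_div_cancel₀ _ hs) rfl rfl rfl rfl rfl rfl rfl
  rw [TwentyV.a₂_mul_a₃_div, TwentyV.Z6VRefined, ← key]
  have hτ : TwentyV.tauTilde η lam μ σ = σ * ((σ * Complex.sin ((lam : ℂ) - η) *
      Complex.sin (((lam : ℂ) + 3 * η + μ) / 2) - Complex.sin ((lam : ℂ) + η) *
      Complex.sin (((lam : ℂ) - η + μ) / 2)) / Complex.sin (2 * η)) *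
      Complex.sin (((lam : ℂ) + 3 * η - μ) / 2) / (Complex.sin (((lam : ℂ) - η - μ) / 2) *
        (TwentyV.denomTilde η lam μ σ / Complex.sin (2 * η))) := by
    rw [TwentyV.tauTilde]
    generalize Complex.sin (2 * (η : ℂ)) = s at *
    field_simp
  have hg : TwentyV.gTilde η lam μ σ = σ * Complex.sin (((lam : ℂ) + 3 * η - μ) / 2) /
      (TwentyV.denomTilde η lam μ σ / Complex.sin (2 * η)) := by
    rw [TwentyV.gTilde]
    generalize Complex.sin (2 * (η : ℂ)) = s at *
    field_simp
  rw [hτ, hg]
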